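/- Let $d\ge 1$, $\alpha=(\alpha_1,\dots,\alpha_d)$ with all $\alpha_i>0$, and $p\in(0,1)$. **Notation.** For a vector $v$, $|v|=\sum_i v_i$; $a_{(k)}=a(a+1)\cdots(a+k-1)$; for $n\in\mathbb N^d$ put $n'=(n_1,\dots,n_{d-1})$. $\gamma_{a,b}$ is the Gamma law with density $z^{a-1}e^{-z/b}/(\Gamma(a)b^a)$ on $(0,\infty)$, and $\gamma^d_{\alpha,b}=\prod_i\gamma_{\alpha_i,b}$. $D_\alpha$ is the Dirichlet law on the simplex (of $(x_1,\dots,x_{d-1},1-x_1-\dots-x_{d-1})$, with density $\frac{\Gamma(|\alpha|)}{\prod_i\Gamma(\alpha_i)}\prod_{i<d}x_i^{\alpha_i-1}(1-\sum_{i<d}x_i)^{\alpha_d-1}$), and $DM_\alpha(m)=\frac{|m|!}{\prod_i m_i!}\frac{\prod_i(\alpha_i)_{(m_i)}}{|\alpha|_{(|m|)}}$. $Po^d_\lambda(r)=\prod_i\lambda_i^{r_i}e^{-\lambda_i}/r_i!$ and $NB^d_{\alpha,p}(r)=\prod_i\frac{(\alpha_i)_{(r_i)}}{r_i!}p^{r_i}(1-p)^{\alpha_i}$,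 $r\in\mathbb N^d$. - Laguerre: $L_n^{a}(y)=\frac{a_{(n)}}{n!}\,{}_1F_1(-n;a;y)$, $\;L_n^\alpha(y)=\prod_{i=1}^d L_{n_i}^{\alpha_i}(y_i)$ for $n\in\mathbb N^d$, and $1/\varphi_m=\prod_i(\alpha_i)_{(m_i)}/m_i!$. - Jacobi: $R_n^{a,b}(x)={}_2F_1(-n,n+a+b-1;b;1-x)$; on the simplex, for $l\in\mathbb N^{d-1}$, $$R_l^\alpha(x)=\prod_{j=1}^{d-1}R_{l_j}^{\alpha_j,\,A_j+2N_j}\Big(\frac{x_j}{1-s_{j-1}}\Big)(1-s_{j-1})^{l_j},$$ with $A_j=\sum_{i=j+1}^d\alpha_i$, $N_j=\sum_{i=j+1}^{d-1}l_i$, $s_j=\sum_{i\le j}x_i$. - Multiple Laguerre: $L_n^{\alpha*}(y)=L_{n_d}^{|\alpha|+2|n'|}(|y|)\,|y|^{|n'|}\,R_{n'}^\alpha(y/|y|)$. - Meixner and Hahn: $\widetilde M_n^{a,p}(x)=\int_0^\infty L_n^a\big(\lambda\tfrac{1-p}p\big)\gamma_{a+x,p}(d\lambda)$ for real $x>-a$;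 $\;\widetilde q_l^{\,\alpha}(r;|r|)=\int R_l^\alpha\,dD_{\alpha+r}$. - Laguerre connection coefficients: $c^*_m(n)=\int L_n^{\alpha*}L_m^\alpha\,d\gamma^d_{\alpha,1}$ for $m,n\in\mathbb N^d$. - Lauricella function: $F_A(a;b;c;z)=\sum_{l}\,a_{(|l|)}\prod_i\frac{(b_i)_{(l_i)}}{(c_i)_{(l_i)}\,l_i!}z_i^{l_i}$. **Proposition.** (i) The functions of $r\in\mathbb N^d$ $$\widetilde M_n^{\alpha,p}(r)=\prod_{i=1}^d\widetilde M_{n_i}^{\alpha_i,p}(r_i),\qquad {}^*\widetilde M_n^{\alpha,p}(r)=(1-p)^{|n'|}\,\widetilde M_{n_d}^{|\alpha|+2|n'|,p}(|r|-|n'|)\,(|\alpha|+|r|)_{(|n'|)}\,\widetilde q_{n'}^{\,\alpha}(r;|r|),\qquad n\in\mathbb N^d,$$ are two systems of orthogonal polynomials with weight $NB^d_{\alpha,p}$: in each system the $n$-th member is a polynomial of total degree $|n|$, distinct members are orthogonal, all squared norms are finite and positive, and the $n$-th member is orthogonal to every polynomial of total degree less than $|n|$. (ii) For all $n,r\in\mathbb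 N^d$, all integrands below being integrable, $$\widetilde M_n^{\alpha,p}(r)=\int\frac{Po^d_\lambda(r)}{NB^d_{\alpha,p}(r)}L_n^\alpha\big(\lambda\tfrac{1-p}p\big)\gamma^d_{\alpha,\frac p{1-p}}(d\lambda)=\int L_n^\alpha\big(\lambda\tfrac{1-p}p\big)\gamma^d_{\alpha+r,p}(d\lambda),$$ $${}^*\widetilde M_n^{\alpha,p}(r)=\int\frac{Po^d_\lambda(r)}{NB^d_{\alpha,p}(r)}L_n^{\alpha*}\big(\lambda\tfrac{1-p}p\big)\gamma^d_{\alpha,\frac p{1-p}}(d\lambda)=\int L_n^{\alpha*}\big(\lambda\tfrac{1-p}p\big)\gamma^d_{\alpha+r,p}(d\lambda).$$ (iii) The connection coefficients of the two Meixner systems are those of the two Laguerre systems: for every $n\in\mathbb N^d$, all $y\in(0,\infty)^d$ and all $r\in\mathbb N^d$, $$L_n^{\alpha*}(y)=\sum_{|m|=|n|}\varphi_m\,c^*_m(n)\,L_m^\alpha(y),\qquad {}^*\widetilde M_n^{\alpha,p}(r)=\sum_{|m|=|n|}\varphi_m\,c^*_m(n)\,\widetilde M_m^{\alpha,p}(r).$$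 Equivalently, if $R$ has law $NB^d_{\alpha,p}$, then for all $m,n\in\mathbb N^d$ (the expectation and the integral defining $c^*_m(n)$ converging absolutely) $$\mathbb E\big[{}^*\widetilde M_n^{\alpha,p}(R)\,\widetilde M_m^{\alpha,p}(R)\big]=p^{|n|}\,c^*_m(n).$$ Here $c^*_m(n)=0$ if $|m|\ne|n|$, and if $|m|=|n|$ $$c^*_m(n)=\frac{|\alpha|_{(|n|)}}{|n|!}DM_\alpha(m)\sum_{j=0}^{|n|}d_j\,\frac{|\alpha|_{(j)}}{j!}\int R_{n'}^\alpha(t)\,F_A\big(|\alpha|;(-m,-j);(\alpha,|\alpha|);(t,1)\big)\,D_\alpha(dt),$$ $$d_j=\sum_{i=0}^{|n'|}(-|n'|)_{(i)}\frac{|\alpha|_{(|n'|)}(|\alpha|+2|n'|)_{(n_d)}}{i!\,n_d!}F_A\big(|\alpha|;(-i,-n_d,-j);(|\alpha|,|\alpha|+2|n'|,|\alpha|);(1,1,1)\big).$$ -/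

import Mathlib

open MeasureTheory ProbabilityTheory

noncomputable section

namespace MultiMeixner

/-- The rising factorial `a (a + 1) ⋯ (a + k - 1)`. -/
def rising (a : ℝ) (k : ℕ) : ℝ := (ascPochhammer ℝ k).eval a

/-! ### Univariate polynomials -/

/-- Laguerre polynomials with positive parameter `a`:
`L_n^a(y) = (a)_n / n! * ₁F₁(-n; a; y)` (the series terminates at `k = n`). -/
def laguerre (a : ℝ) (n : ℕ) (y : ℝ) : ℝ :=
  rising a n / n.factorial *
    ∑ k ∈ Finset.range (n + 1), rising (-(n : ℝ)) k / (rising a k * k.factorial) * y ^ k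

/-- Jacobi polynomials on `[0, 1]`, orthogonal for the Beta `(a, b)` law and standardized to be
`1` at `1`: `R_n^{a,b}(x) = ₂F₁(-n, n + a + b - 1; b; 1 - x)`. -/
def jacobi (a b : ℝ) (n : ℕ) (x : ℝ) : ℝ :=
  ∑ k ∈ Finset.range (n + 1),
    rising (-(n : ℝ)) k * rising (n + a + b - 1) k / (rising b k * k.factorial) * (1 - x) ^ k

/-- The Gamma law with shape `a` and scale `b`, of density
`z ^ (a - 1) * exp (-z / b) / (Γ(a) * b ^ a)` on `(0, ∞)`. -/
def gammaLaw (a b : ℝ) : Measure ℝ := gammaMeasure a b⁻¹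

/-- Meixner polynomials as posterior Gamma mixtures of Laguerre polynomials. The argument `x` is a
real number with `a + x > 0`, so that the polynomial may also be evaluated at negative points. -/
def meixner (a p : ℝ) (n : ℕ) (x : ℝ) : ℝ :=
  ∫ z, laguerre a n (z * ((1 - p) / p)) ∂(gammaLaw (a + x) p)

/-! ### Multivariate laws. The dimension is `d = k + 1` with `k : ℕ` -/

/-- The product of Gamma laws with shapes `α i` and common scale `b`. -/
def gammaProd {d : ℕ} (α : Fin d → ℝ) (b : ℝ) : Measure (Fin d → ℝ) :=
  Measure.pi fun i => gammaLaw (α i) b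

/-- The product Poisson likelihood `Po_y^d(r)`. -/
def poissonProd {d : ℕ} (y : Fin d → ℝ) (r : Fin d → ℕ) : ℝ :=
  ∏ i, y i ^ r i * Real.exp (-y i) / (r i).factorial

/-- The Negative Binomial weights `NB_{a,p}(j)`. -/
def nbWeight (a p : ℝ) (j : ℕ) : ℝ :=
  rising a j / j.factorial * p ^ j * (1 - p) ^ a

/-- The product Negative Binomial weights `NB_{α,p}^d(r)`. -/
def nbProd {d : ℕ} (α : Fin d → ℝ) (p : ℝ) (r : Fin d → ℕ) : ℝ :=
  ∏ i, nbWeight (α i) p (r i)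

/-- The density of the Dirichlet law in the first `k` coordinates. -/
def dirichletDensity {k : ℕ} (α : Fin (k + 1) → ℝ) (x : Fin k → ℝ) : ℝ :=
  Real.Gamma (∑ i, α i) / (∏ i, Real.Gamma (α i)) *
    (∏ i : Fin k, x i ^ (α i.castSucc - 1)) * (1 - ∑ i, x i) ^ (α (Fin.last k) - 1)

/-- The Dirichlet law with parameter `α` on `k + 1` points, as the law of
`(x_1, …, x_k, 1 - x_1 - ⋯ - x_k)`. -/
def dirichlet {k : ℕ} (α : Fin (k + 1) → ℝ) : Measure (Fin (k + 1) → ℝ) :=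
  ((volume : Measure (Fin k → ℝ)).withDensity fun x =>
    Set.indicator {x : Fin k → ℝ | (∀ i, 0 ≤ x i) ∧ ∑ i, x i ≤ 1}
      (fun x => ENNReal.ofReal (dirichletDensity α x)) x).map
    fun x => (Fin.snoc x (1 - ∑ i, x i) : Fin (k + 1) → ℝ)

/-- The Dirichlet-Multinomial probability `DM_α(m)`. -/
def dirichletMultinomial {d : ℕ} (α : Fin d → ℝ) (m : Fin d → ℕ) : ℝ :=
  ((∑ i, m i).factorial : ℝ) / (∏ i, ((m i).factorial : ℝ)) *
    ((∏ i, rising (α i) (m i)) / rising (∑ i, α i) (∑ i, m i))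

/-! ### Multivariate polynomials -/

/-- Jacobi polynomials on the simplex, built from right-neutrality: the product over `j ≤ k` of
`R_{n_j}^{(α_j, A_j + 2 N_j)}(x_j / (1 - s_{j-1})) * (1 - s_{j-1}) ^ n_j`, where
`A_j = α_{j+1} + ⋯ + α_{k+1}`, `N_j = n_{j+1} + ⋯ + n_k`, `s_{j-1} = x_1 + ⋯ + x_{j-1}`. -/
def jacobiSimplex {k : ℕ} (α : Fin (k + 1) → ℝ) (n : Fin k → ℕ) (x : Fin (k + 1) → ℝ) : ℝ :=
  ∏ j : Fin k,
    jacobi (α j.castSucc)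
        ((∑ i ∈ Finset.Ioi j.castSucc, α i) + 2 * ((∑ i ∈ Finset.Ioi j, n i : ℕ) : ℝ)) (n j)
        (x j.castSucc / (1 - ∑ i ∈ Finset.Iio j.castSucc, x i)) *
      (1 - ∑ i ∈ Finset.Iio j.castSucc, x i) ^ n j

/-- Multivariate Hahn polynomials as posterior Dirichlet mixtures of Jacobi polynomials. -/
def hahn {k : ℕ} (α : Fin (k + 1) → ℝ) (n : Fin k → ℕ) (r : Fin (k + 1) → ℕ) : ℝ :=
  ∫ x, jacobiSimplex α n x ∂(dirichlet fun i => α i + r i)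

/-- The product Laguerre system. -/
def laguerreProd {d : ℕ} (α : Fin d → ℝ) (n : Fin d → ℕ) (y : Fin d → ℝ) : ℝ :=
  ∏ i, laguerre (α i) (n i) (y i)

/-- The multiple Laguerre system built from a univariate Laguerre polynomial in `|y|` and the
Jacobi polynomials on the simplex in `y / |y|`. Here `n' = Fin.init n`. -/
def laguerreStar {k : ℕ} (α : Fin (k + 1) → ℝ) (n : Fin (k + 1) → ℕ) (y : Fin (k + 1) → ℝ) : ℝ :=
  laguerre ((∑ i, α i) + 2 * ((∑ i : Fin k, n i.castSucc : ℕ) : ℝ)) (n (Fin.last k)) (∑ i, y i) *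
    (∑ i, y i) ^ (∑ i : Fin k, n i.castSucc) *
    jacobiSimplex α (fun i : Fin k => n i.castSucc) (fun i => y i / ∑ l, y l)

/-- The product Meixner system. -/
def meixnerProd {d : ℕ} (α : Fin d → ℝ) (p : ℝ) (n r : Fin d → ℕ) : ℝ :=
  ∏ i, meixner (α i) p (n i) (r i)

/-- The Meixner system built from a univariate Meixner polynomial in `|r|` and multivariate Hahn
polynomials. -/
def meixnerStar {k : ℕ} (α : Fin (k + 1) → ℝ) (p : ℝ) (n r : Fin (k + 1) → ℕ) : ℝ :=
  (1 - p) ^ (∑ i : Fin k, n i.castSucc) *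
    meixner ((∑ i, α i) + 2 * ((∑ i : Fin k, n i.castSucc : ℕ) : ℝ)) p (n (Fin.last k))
      (((∑ i, r i : ℕ) : ℝ) - ((∑ i : Fin k, n i.castSucc : ℕ) : ℝ)) *
    rising (∑ i, (α i + r i)) (∑ i : Fin k, n i.castSucc) *
    hahn α (fun i : Fin k => n i.castSucc) r

/-! ### Orthogonal systems and connection coefficients -/

/-- `f` is a system of orthogonal polynomials on `ℕ^d` for the weights `w`: `f n` is a polynomial
of exact total degree `|n|`, distinct members are orthogonal, squared norms are finite and
positive, and `f n` is orthogonal to all polynomials of degree less than `|n|`. -/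
def IsOrthogonalSystem {d : ℕ} (w : (Fin d → ℕ) → ℝ) (f : (Fin d → ℕ) → (Fin d → ℕ) → ℝ) :
    Prop :=
  (∀ n, ∃ P : MvPolynomial (Fin d) ℝ, P.totalDegree = ∑ i, n i ∧
    ∀ r : Fin d → ℕ, f n r = MvPolynomial.eval (fun i => (r i : ℝ)) P) ∧
  (∀ n m, n ≠ m → HasSum (fun r => w r * (f n r * f m r)) 0) ∧
  (∀ n, ∃ c : ℝ, 0 < c ∧ HasSum (fun r => w r * f n r ^ 2) c) ∧
  (∀ n, ∀ Q : MvPolynomial (Fin d) ℝ, Q.totalDegree < ∑ i, n i →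
    HasSum (fun r => w r * (f n r * MvPolynomial.eval (fun i => (r i : ℝ)) Q)) 0)

/-- `c*_m(n) = E[L_n^{α*}(Y) L_m^α(Y)]` for `Y` with independent Gamma `(α_i, 1)` coordinates. -/
def connCoeff {k : ℕ} (α : Fin (k + 1) → ℝ) (m n : Fin (k + 1) → ℕ) : ℝ :=
  ∫ y, laguerreStar α n y * laguerreProd α m y ∂(gammaProd α 1)

/-- `φ_m`, the inverse of the squared norm `∏ i, (α_i)_{m_i} / m_i!` of `L_m^α`. -/
def laguerrePhi {d : ℕ} (α : Fin d → ℝ) (m : Fin d → ℕ) : ℝ :=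
  (∏ i, rising (α i) (m i) / (m i).factorial)⁻¹

/-- The Lauricella function of type A,
`F_A(a; b; c; z) = ∑ l, (a)_{|l|} ∏ i, (b_i)_{l_i} / ((c_i)_{l_i} l_i!) * z_i ^ l_i`. -/
def lauricellaA {s : ℕ} (a : ℝ) (b c z : Fin s → ℝ) : ℝ :=
  ∑' l : Fin s → ℕ, rising a (∑ i, l i) *
    ∏ i, rising (b i) (l i) / (rising (c i) (l i) * (l i).factorial) * z i ^ l i

/-- The coefficient `d_j` in the Laguerre expansion
`L_q^{a + 2N}(y) * y ^ N = ∑ j, d_j L_j^a(y)`, in terms of Lauricella functions. -/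
def lauricellaCoeff (a : ℝ) (N q j : ℕ) : ℝ :=
  ∑ i ∈ Finset.range (N + 1),
    rising (-(N : ℝ)) i * (rising a N * rising (a + 2 * N) q / (i.factorial * q.factorial)) *
      lauricellaA a ![-(i : ℝ), -(q : ℝ), -(j : ℝ)] ![a, a + 2 * N, a] ![1, 1, 1]

end MultiMeixner

end

noncomputable section

namespace MultiMeixner

/-! ### Rising factorials -/

/-! Every integral in the statement is an integral of a polynomial, up to a null set, so analysis
enters only through moments. A product of Gamma laws is replaced by the linear functional
`gammaProdMoment`, and orthogonality, degrees and norms are then proved algebraically.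

Let `T` send a polynomial `P` to the function `r ↦ gammaProdMoment (α + r) (1 - p) P`, the posterior
mean of `P` given the Poisson observation `r`. Both Meixner systems are the images under `T` of the
corresponding Laguerre systems (`meixnerProd_eq_gammaProdMoment`, `meixnerStar_eq_gammaProdMoment`).
As `T` is linear, any linear relation among Laguerre polynomials passes to Meixner polynomials with
the same coefficients.

Orthogonality passes as well. Given its mean `λ`, a Poisson variable has falling factorial moments
`λ ^ l`. Hence the negative binomial sum of `T P` against the falling factorial of `r` with exponent
`l` is a multiple of the Gamma pairing of `P` with `X ^ l` (`hasSum_nbProd_mul_descFactorial`). If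
`P` is orthogonal to all degrees below `N`, only the part of degree `N` of the other factor matters.
For `deg Q ≤ N` this gives `⟨T P, T Q⟩ = p ^ N ⟨P, Q⟩` (`OrthogonalBelow.hasSum_nbProd_mul`).

For the multiple Laguerre system the essential fact is the independence of `|Y|` and `Y / |Y|` for
independent Gamma variables, in the algebraic form `gammaProdMoment_aeval_xSum_mul`: a homogeneous
factor of degree `M` separates from a function of `|Y|` and raises the shape of `|Y|` by `M`. This
accounts for the parameters `|α| + 2|n'|` and, one coordinate at a time, for `A_j + 2 N_j`.

For the explicit coefficients, a Lauricella function with negative integer numerator parameters is a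
Gamma moment of a product of `₁F₁` polynomials (`lauricellaA_neg_natCast`). Thus `d_j` is a
Fourier–Laguerre coefficient, and Parseval's identity removes the sum over `j`. -/

@[simp] lemma rising_zero (a : ℝ) : rising a 0 = 1 := by simp [rising]

lemma rising_succ (a : ℝ) (k : ℕ) : rising a (k + 1) = rising a k * (a + k) := by
  simp [rising, ascPochhammer_succ_eval]

lemma rising_add (a : ℝ) (m n : ℕ) : rising a (m + n) = rising a m * rising (a + m) n := by
  induction n with
  | zero => simp
  | succ n ih => rw [← add_assoc, rising_succ, rising_succ, ih]; push_cast; ring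

lemma rising_pos {a : ℝ} (ha : 0 < a) (k : ℕ) : 0 < rising a k := ascPochhammer_pos k a ha

lemma rising_neg_natCast (n k : ℕ) :
    rising (-(n : ℝ)) k = (-1) ^ k * (k.factorial * n.choose k) := by
  rw [rising, ascPochhammer_eval_neg_eq_descPochhammer, descPochhammer_eval_eq_descFactorial,
    Nat.descFactorial_eq_factorial_mul_choose]
  push_cast; ring

lemma gamma_add_natCast {a : ℝ} (ha : 0 < a) (k : ℕ) :
    Real.Gamma (a + k) = rising a k * Real.Gamma a := by
  induction k with
  | zero => simp
  | succ k ih =>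
    rw [rising_succ, Nat.cast_succ, ← add_assoc, Real.Gamma_add_one (by positivity), ih]; ring

/-! ### Alternating sums of polynomials -/

/-- The alternating binomial sum is an `n`-th forward difference at `0`, so it annihilates
polynomials of degree below `n`. The Laguerre and Jacobi orthogonality relations both come down to
this. -/
lemma sum_alternating_choose_eval (q : Polynomial ℝ) (n : ℕ) :
    ∑ k ∈ Finset.range (n + 1), (-1 : ℝ) ^ k * n.choose k * q.eval (k : ℝ) =
      (-1) ^ n * (fwdDiff 1)^[n] q.eval 0 := by
  rw [fwdDiff_iter_eq_sum_shift, Finset.mul_sum]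
  refine Finset.sum_congr rfl fun k hk => ?_
  obtain ⟨j, rfl⟩ := Nat.exists_eq_add_of_le (Nat.lt_succ_iff.1 (Finset.mem_range.1 hk))
  have : ((-1 : ℝ) ^ j) * (-1) ^ j = 1 := by rw [← mul_pow]; simp
  simp only [zsmul_eq_mul, Nat.add_sub_cancel_left]
  push_cast
  rw [pow_add]
  simp only [zero_add, nsmul_eq_mul, mul_one]
  linear_combination (-(-1 : ℝ) ^ k * ((k + j).choose k) * Polynomial.eval (k : ℝ) q) * this

lemma sum_alternating_choose_eval_eq_zero {q : Polynomial ℝ} {n : ℕ} (hq : q.natDegree < n) :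
    ∑ k ∈ Finset.range (n + 1), (-1 : ℝ) ^ k * n.choose k * q.eval (k : ℝ) = 0 := by
  rw [sum_alternating_choose_eval, Polynomial.fwdDiff_iter_eq_zero_of_degree_lt hq]
  simp

lemma sum_alternating_choose_eval_of_natDegree_eq {q : Polynomial ℝ} {n : ℕ}
    (hq : q.natDegree = n) :
    ∑ k ∈ Finset.range (n + 1), (-1 : ℝ) ^ k * n.choose k * q.eval (k : ℝ) =
      (-1) ^ n * (q.leadingCoeff * n.factorial) := by
  subst hq
  rw [sum_alternating_choose_eval, Polynomial.fwdDiff_iter_degree_eq_factorial]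
  simp

/-! ### Univariate moment functionals and Laguerre polynomials -/

/-- The linear functional `X ^ k ↦ s ^ k * (a)_k`: expectation under a Gamma law of shape `a`
and scale `s`. -/
def gammaMoment (a s : ℝ) : Polynomial ℝ →ₗ[ℝ] ℝ :=
  Polynomial.lsum fun k => (s ^ k * rising a k) • LinearMap.id

lemma gammaMoment_monomial (a s : ℝ) (k : ℕ) (c : ℝ) :
    gammaMoment a s (Polynomial.monomial k c) = c * (s ^ k * rising a k) := by
  simp [gammaMoment, Polynomial.lsum_apply, Polynomial.sum_monomial_index, mul_comm]

lemma gammaMoment_X_pow (a s : ℝ) (k : ℕ) :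
    gammaMoment a s (Polynomial.X ^ k) = s ^ k * rising a k := by
  rw [← Polynomial.monomial_one_right_eq_X_pow, gammaMoment_monomial, one_mul]

/-- The linear map `X ^ k ↦ X ^ k / (a)_k`. -/
def divRising (a : ℝ) : Polynomial ℝ →ₗ[ℝ] Polynomial ℝ :=
  Polynomial.lsum fun k => (rising a k)⁻¹ • Polynomial.monomial k

lemma divRising_monomial (a : ℝ) (k : ℕ) (c : ℝ) :
    divRising a (Polynomial.monomial k c) = Polynomial.monomial k (c / rising a k) := by
  simp [divRising, Polynomial.lsum_apply, Polynomial.sum_monomial_index,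
    Polynomial.smul_monomial, div_eq_inv_mul]

/-- The polynomial `₁F₁(-n; a; X)`. -/
def kummerPoly (a : ℝ) (n : ℕ) : Polynomial ℝ :=
  ∑ k ∈ Finset.range (n + 1), Polynomial.monomial k ((-1) ^ k * n.choose k / rising a k)

lemma kummerPoly_eq_divRising (a : ℝ) (n : ℕ) :
    kummerPoly a n = divRising a ((1 - Polynomial.X) ^ n) := by
  have : (1 - Polynomial.X : Polynomial ℝ) ^ n =
      ∑ k ∈ Finset.range (n + 1), Polynomial.monomial k ((-1 : ℝ) ^ k * n.choose k) := by
    rw [sub_eq_neg_add, add_pow]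
    refine Finset.sum_congr rfl fun k _ => ?_
    rw [neg_pow, one_pow, mul_one, ← Polynomial.C_mul_X_pow_eq_monomial]
    simp only [map_mul, map_pow, map_neg, map_one, map_natCast]
    ring
  rw [this, map_sum, kummerPoly]
  simp only [divRising_monomial]

lemma coeff_kummerPoly (a : ℝ) (n k : ℕ) :
    (kummerPoly a n).coeff k = (-1) ^ k * n.choose k / rising a k := by
  simp only [kummerPoly, Polynomial.finsetSum_coeff, Polynomial.coeff_monomial]
  rw [Finset.sum_ite_eq']
  split_ifs with h
  · rfl
  · rw [Nat.choose_eq_zero_of_lt (by simpa using h)]; simp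

lemma natDegree_kummerPoly_le (a : ℝ) (n : ℕ) : (kummerPoly a n).natDegree ≤ n :=
  Polynomial.natDegree_le_iff_coeff_eq_zero.2 fun k hk => by
    rw [coeff_kummerPoly, Nat.choose_eq_zero_of_lt hk]; simp

lemma rising_neg_div (a : ℝ) (n k : ℕ) :
    rising (-(n : ℝ)) k / (rising a k * k.factorial) = (-1) ^ k * n.choose k / rising a k := by
  rw [rising_neg_natCast]
  have : (k.factorial : ℝ) ≠ 0 := by positivity
  -- Nothing is assumed on `a`: if `(a)_k = 0`, both sides are `0` by the convention for division by
  -- zero.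
  by_cases h : rising a k = 0
  · simp [h]
  · field_simp

/-- The Laguerre polynomial as a polynomial. -/
def laguerrePoly (a : ℝ) (n : ℕ) : Polynomial ℝ :=
  Polynomial.C (rising a n / n.factorial) * kummerPoly a n

lemma eval_kummerPoly (a : ℝ) (n : ℕ) (y : ℝ) : (kummerPoly a n).eval y =
    ∑ k ∈ Finset.range (n + 1), rising (-(n : ℝ)) k / (rising a k * k.factorial) * y ^ k := by
  simp [kummerPoly, Polynomial.eval_finsetSum, rising_neg_div]

lemma eval_laguerrePoly (a : ℝ) (n : ℕ) (y : ℝ) :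
    (laguerrePoly a n).eval y = laguerre a n y := by
  simp [laguerrePoly, laguerre, eval_kummerPoly]

lemma natDegree_laguerrePoly_le (a : ℝ) (n : ℕ) : (laguerrePoly a n).natDegree ≤ n :=
  (Polynomial.natDegree_C_mul_le _ _).trans (natDegree_kummerPoly_le a n)

/-- `divRising a` maps `(1 - X) ^ i` to `₁F₁(-i; a; X)`, so the formula is the binomial expansion of
`X ^ n = (1 - (1 - X)) ^ n` carried through that map. -/
lemma X_pow_eq_sum_kummerPoly {a : ℝ} (ha : 0 < a) (n : ℕ) :
    (Polynomial.X ^ n : Polynomial ℝ) =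
      ∑ i ∈ Finset.range (n + 1),
        Polynomial.C (rising (-(n : ℝ)) i * rising a n / i.factorial) * kummerPoly a i := by
  have h1 : (Polynomial.X ^ n : Polynomial ℝ) = rising a n • divRising a (Polynomial.X ^ n) := by
    rw [← Polynomial.monomial_one_right_eq_X_pow, divRising_monomial, Polynomial.smul_monomial,
      smul_eq_mul, mul_one_div_cancel (rising_pos ha n).ne']
  have h2 : (Polynomial.X ^ n : Polynomial ℝ) =
      ∑ i ∈ Finset.range (n + 1), ((-1 : ℝ) ^ i * n.choose i) • (1 - Polynomial.X) ^ i := by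
    conv_lhs => rw [show (Polynomial.X : Polynomial ℝ) = -(1 - Polynomial.X) + 1 by ring, add_pow]
    refine Finset.sum_congr rfl fun k _ => ?_
    rw [neg_pow, one_pow, mul_one, Polynomial.smul_eq_C_mul]
    simp only [map_mul, map_pow, map_neg, map_one, map_natCast]
    ring
  rw [h1]
  conv_lhs => rw [h2]
  rw [map_sum, Finset.smul_sum]
  refine Finset.sum_congr rfl fun k _ => ?_
  rw [map_smul, ← kummerPoly_eq_divRising, smul_smul, Polynomial.smul_eq_C_mul,
    rising_neg_natCast]
  congr 2
  have : (k.factorial : ℝ) ≠ 0 := by positivity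
  field_simp

lemma natDegree_ascPochhammer_comp (c : ℝ) (l : ℕ) :
    ((ascPochhammer ℝ l).comp (Polynomial.X + Polynomial.C c)).natDegree = l := by
  rw [Polynomial.natDegree_comp, Polynomial.natDegree_X_add_C, mul_one, ascPochhammer_natDegree]

lemma monic_ascPochhammer_comp (c : ℝ) (l : ℕ) :
    ((ascPochhammer ℝ l).comp (Polynomial.X + Polynomial.C c)).Monic :=
  (monic_ascPochhammer ℝ l).comp_X_add_C c

lemma eval_ascPochhammer_comp (c x : ℝ) (l : ℕ) :
    ((ascPochhammer ℝ l).comp (Polynomial.X + Polynomial.C c)).eval x = rising (c + x) l := by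
  simp [rising, add_comm]

/-- The moment `(a)_{k+l}` divided by the coefficient's `(a)_k` is `(a + k)_l`, a monic polynomial
of degree `l` in `k`. The pairing is therefore an alternating binomial sum. -/
lemma gammaMoment_kummerPoly_mul_X_pow {a : ℝ} (ha : 0 < a) (n l : ℕ) :
    gammaMoment a 1 (kummerPoly a n * Polynomial.X ^ l) =
      ∑ k ∈ Finset.range (n + 1), (-1 : ℝ) ^ k * n.choose k *
        ((ascPochhammer ℝ l).comp (Polynomial.X + Polynomial.C a)).eval (k : ℝ) := by
  simp only [kummerPoly, Finset.sum_mul, map_sum, Polynomial.monomial_mul_X_pow,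
    gammaMoment_monomial, eval_ascPochhammer_comp, one_pow, one_mul]
  refine Finset.sum_congr rfl fun k _ => ?_
  rw [rising_add]
  field_simp [(rising_pos ha k).ne']

lemma gammaMoment_kummerPoly_mul_X_pow_eq_zero {a : ℝ} (ha : 0 < a) {n l : ℕ} (hl : l < n) :
    gammaMoment a 1 (kummerPoly a n * Polynomial.X ^ l) = 0 := by
  rw [gammaMoment_kummerPoly_mul_X_pow ha]
  exact sum_alternating_choose_eval_eq_zero (by rwa [natDegree_ascPochhammer_comp])

lemma gammaMoment_kummerPoly_mul_X_pow_self {a : ℝ} (ha : 0 < a) (n : ℕ) :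
    gammaMoment a 1 (kummerPoly a n * Polynomial.X ^ n) = (-1) ^ n * n.factorial := by
  rw [gammaMoment_kummerPoly_mul_X_pow ha,
    sum_alternating_choose_eval_of_natDegree_eq (natDegree_ascPochhammer_comp a n),
    (monic_ascPochhammer_comp a n).leadingCoeff, one_mul]

lemma gammaMoment_kummerPoly_mul {a : ℝ} (ha : 0 < a) (n : ℕ) {q : Polynomial ℝ}
    (hq : q.natDegree ≤ n) :
    gammaMoment a 1 (kummerPoly a n * q) = (-1) ^ n * n.factorial * q.coeff n := by
  conv_lhs => rw [q.as_sum_range' (n + 1) (Nat.lt_succ_of_le hq)]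
  rw [Finset.mul_sum, map_sum, Finset.sum_range_succ, Finset.sum_eq_zero fun l hl => ?_, zero_add]
  · rw [← Polynomial.C_mul_X_pow_eq_monomial, ← Polynomial.smul_eq_C_mul, mul_smul_comm, map_smul,
      gammaMoment_kummerPoly_mul_X_pow_self ha, smul_eq_mul, mul_comm]
  · rw [← Polynomial.C_mul_X_pow_eq_monomial, ← Polynomial.smul_eq_C_mul, mul_smul_comm, map_smul,
      gammaMoment_kummerPoly_mul_X_pow_eq_zero ha (Finset.mem_range.1 hl), smul_zero]

lemma gammaMoment_kummerPoly_mul_kummerPoly {a : ℝ} (ha : 0 < a) (n m : ℕ) :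
    gammaMoment a 1 (kummerPoly a n * kummerPoly a m) =
      if n = m then n.factorial / rising a n else 0 := by
  wlog h : m ≤ n generalizing n m
  · rw [mul_comm, this m n (by omega)]
    split_ifs with h1 h2 h2
    · rw [h1]
    · omega
    · omega
    · rfl
  rw [gammaMoment_kummerPoly_mul ha n ((natDegree_kummerPoly_le a m).trans h), coeff_kummerPoly]
  split_ifs with h1
  · subst h1
    have : ((-1 : ℝ) ^ n) * (-1) ^ n = 1 := by rw [← mul_pow]; simp
    rw [Nat.choose_self, Nat.cast_one, mul_one, mul_div_assoc', mul_right_comm, this, one_mul]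
  · rw [Nat.choose_eq_zero_of_lt (by omega)]; simp

/-- Expansion of a polynomial in the orthogonal system `₁F₁(-j; a; X)`. -/
lemma eq_sum_gammaMoment_mul_kummerPoly {a : ℝ} (ha : 0 < a) {q : Polynomial ℝ} {n : ℕ}
    (hq : q.natDegree ≤ n) :
    q = ∑ j ∈ Finset.range (n + 1),
      (gammaMoment a 1 (q * kummerPoly a j) * (rising a j / j.factorial)) • kummerPoly a j := by
  -- The identity is linear in `q`. It holds for the polynomials `kummerPoly a i` by orthogonality,
  -- hence for powers of `X`, which are combinations of these, and hence for `q`.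
  have hk : ∀ i ≤ n, kummerPoly a i = ∑ j ∈ Finset.range (n + 1),
      (gammaMoment a 1 (kummerPoly a i * kummerPoly a j) * (rising a j / j.factorial)) •
        kummerPoly a j := by
    intro i hi
    rw [Finset.sum_eq_single_of_mem i (Finset.mem_range.2 (Nat.lt_succ_of_le hi))]
    · rw [gammaMoment_kummerPoly_mul_kummerPoly ha, if_pos rfl]
      have := (rising_pos ha i).ne'
      have : (i.factorial : ℝ) ≠ 0 := by positivity
      rw [show (i.factorial / rising a i : ℝ) * (rising a i / i.factorial) = 1 by field_simp,
        one_smul]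
    · intro j _ hj
      rw [gammaMoment_kummerPoly_mul_kummerPoly ha, if_neg (Ne.symm hj)]; simp
  have hX : ∀ l ≤ n, (Polynomial.X ^ l : Polynomial ℝ) = ∑ j ∈ Finset.range (n + 1),
      (gammaMoment a 1 (Polynomial.X ^ l * kummerPoly a j) * (rising a j / j.factorial)) •
        kummerPoly a j := by
    intro l hl
    have h := X_pow_eq_sum_kummerPoly ha l
    simp only [← Polynomial.smul_eq_C_mul] at h
    conv_rhs => enter [2, j]; rw [h]
    conv_lhs => rw [h]
    simp only [Finset.sum_mul, map_sum, smul_mul_assoc, map_smul, smul_eq_mul, Finset.sum_smul]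
    rw [Finset.sum_comm]
    refine Finset.sum_congr rfl fun i hi => ?_
    conv_lhs => rw [hk i (by have := Finset.mem_range.1 hi; omega), Finset.smul_sum]
    simp only [smul_smul, mul_assoc]
  have hs := q.as_sum_range' (n + 1) (Nat.lt_succ_of_le hq)
  simp only [← Polynomial.C_mul_X_pow_eq_monomial, ← Polynomial.smul_eq_C_mul] at hs
  conv_rhs => enter [2, j]; rw [hs]
  conv_lhs => rw [hs]
  simp only [Finset.sum_mul, map_sum, smul_mul_assoc, map_smul, smul_eq_mul, Finset.sum_smul]
  rw [Finset.sum_comm]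
  refine Finset.sum_congr rfl fun i hi => ?_
  conv_lhs => rw [hX i (by have := Finset.mem_range.1 hi; omega), Finset.smul_sum]
  simp only [smul_smul, mul_assoc]

/-! ### Multivariate monomials and moment functionals -/

/-- The monomial `∏ i, X i ^ m i`. -/
def xPow {d : ℕ} (m : Fin d → ℕ) : MvPolynomial (Fin d) ℝ := ∏ i, MvPolynomial.X i ^ m i

/-- The sum of the variables. -/
def xSum (d : ℕ) : MvPolynomial (Fin d) ℝ := ∑ i, MvPolynomial.X i

lemma xPow_eq_monomial {d : ℕ} (m : Fin d → ℕ) :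
    xPow m = MvPolynomial.monomial (Finsupp.equivFunOnFinite.symm m) 1 := by
  rw [MvPolynomial.monomial_eq, xPow, map_one, one_mul, Finsupp.prod_fintype _ _ (by simp)]
  simp

lemma monomial_one_eq_xPow {d : ℕ} (m : Fin d →₀ ℕ) :
    (MvPolynomial.monomial m (1 : ℝ)) = xPow (⇑m) := by
  rw [xPow_eq_monomial]; congr; ext; simp

lemma eq_sum_smul_xPow {d : ℕ} (P : MvPolynomial (Fin d) ℝ) :
    P = ∑ m ∈ P.support, P.coeff m • xPow (⇑m) := by
  conv_lhs => rw [P.as_sum]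
  simp only [← monomial_one_eq_xPow, MvPolynomial.smul_monomial, smul_eq_mul, mul_one]

lemma sum_le_totalDegree {d : ℕ} {P : MvPolynomial (Fin d) ℝ} {m : Fin d →₀ ℕ}
    (hm : m ∈ P.support) : ∑ i, m i ≤ P.totalDegree := by
  have := MvPolynomial.le_totalDegree hm
  rwa [Finsupp.sum_fintype _ _ (by simp)] at this

lemma sum_eq_of_isHomogeneous {d M : ℕ} {P : MvPolynomial (Fin d) ℝ} (hP : P.IsHomogeneous M)
    {m : Fin d →₀ ℕ} (hm : m ∈ P.support) : ∑ i, m i = M := by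
  rw [← Finsupp.degree_eq_sum]
  by_contra h
  exact MvPolynomial.mem_support_iff.1 hm (hP.coeff_eq_zero h)

/-- Several identities below carry a constant depending on the degree, so they can be checked on
monomials of one fixed degree but not on the whole ring at once. -/
lemma linearMap_eq_of_isHomogeneous {d M : ℕ} {E : Type*} [AddCommGroup E] [Module ℝ E]
    {L₁ L₂ : MvPolynomial (Fin d) ℝ →ₗ[ℝ] E}
    (h : ∀ m : Fin d → ℕ, ∑ i, m i = M → L₁ (xPow m) = L₂ (xPow m))
    {P : MvPolynomial (Fin d) ℝ} (hP : P.IsHomogeneous M) : L₁ P = L₂ P := by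
  rw [eq_sum_smul_xPow P, map_sum, map_sum]
  refine Finset.sum_congr rfl fun m hm => ?_
  rw [map_smul, map_smul, h _ (sum_eq_of_isHomogeneous hP hm)]

lemma linearMap_eq_of_totalDegree_le {d N : ℕ} {E : Type*} [AddCommGroup E] [Module ℝ E]
    {L₁ L₂ : MvPolynomial (Fin d) ℝ →ₗ[ℝ] E}
    (h : ∀ m : Fin d → ℕ, ∑ i, m i ≤ N → L₁ (xPow m) = L₂ (xPow m))
    {P : MvPolynomial (Fin d) ℝ} (hP : P.totalDegree ≤ N) : L₁ P = L₂ P := by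
  rw [eq_sum_smul_xPow P, map_sum, map_sum]
  refine Finset.sum_congr rfl fun m hm => ?_
  rw [map_smul, map_smul, h _ ((sum_le_totalDegree hm).trans hP)]

lemma linearMap_ext_xPow {d : ℕ} {E : Type*} [AddCommGroup E] [Module ℝ E]
    {L₁ L₂ : MvPolynomial (Fin d) ℝ →ₗ[ℝ] E}
    (h : ∀ m : Fin d → ℕ, L₁ (xPow m) = L₂ (xPow m)) : L₁ = L₂ :=
  LinearMap.ext fun _ => linearMap_eq_of_totalDegree_le (fun m _ => h m) le_rfl

lemma isHomogeneous_xPow {d : ℕ} (m : Fin d → ℕ) : (xPow m).IsHomogeneous (∑ i, m i) :=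
  MvPolynomial.IsHomogeneous.prod _ _ _ fun i _ => MvPolynomial.isHomogeneous_X_pow i (m i)

lemma isHomogeneous_xSum (d : ℕ) : (xSum d).IsHomogeneous 1 :=
  MvPolynomial.IsHomogeneous.sum _ _ _ fun i _ => MvPolynomial.isHomogeneous_X ℝ i

/-- The linear functional `X ^ m ↦ ∏ i, s ^ m_i * (β_i)_{m_i}`: expectation under a product of
Gamma laws of shapes `β_i` and common scale `s`. -/
def gammaProdMoment {d : ℕ} (β : Fin d → ℝ) (s : ℝ) : MvPolynomial (Fin d) ℝ →ₗ[ℝ] ℝ :=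
  (MvPolynomial.basisMonomials (Fin d) ℝ).constr ℝ fun m => ∏ i, s ^ m i * rising (β i) (m i)

lemma gammaProdMoment_xPow {d : ℕ} (β : Fin d → ℝ) (s : ℝ) (m : Fin d → ℕ) :
    gammaProdMoment β s (xPow m) = ∏ i, s ^ m i * rising (β i) (m i) := by
  have := (MvPolynomial.basisMonomials (Fin d) ℝ).constr_basis ℝ
    (fun m => ∏ i, s ^ m i * rising (β i) (m i)) (Finsupp.equivFunOnFinite.symm m)
  rw [MvPolynomial.coe_basisMonomials] at this
  rw [xPow_eq_monomial]
  exact this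

/-- Algebraic form of the independence of the coordinates. -/
lemma gammaProdMoment_prod_aeval {d : ℕ} (β : Fin d → ℝ) (s : ℝ) (q : Fin d → Polynomial ℝ) :
    gammaProdMoment β s (∏ i, Polynomial.aeval (MvPolynomial.X i) (q i)) =
      ∏ i, gammaMoment (β i) s (q i) := by
  have h1 : ∀ i : Fin d, Polynomial.aeval (MvPolynomial.X i : MvPolynomial (Fin d) ℝ) (q i) =
      ∑ k ∈ Finset.range ((q i).natDegree + 1), (q i).coeff k • MvPolynomial.X i ^ k := fun i => by
    rw [Polynomial.aeval_eq_sum_range]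
  have h2 : ∀ i : Fin d, gammaMoment (β i) s (q i) =
      ∑ k ∈ Finset.range ((q i).natDegree + 1), (q i).coeff k * (s ^ k * rising (β i) k) := by
    intro i
    conv_lhs => rw [(q i).as_sum_range]
    simp only [map_sum, gammaMoment_monomial]
  simp only [h1, h2, Finset.prod_univ_sum, map_sum, Finset.prod_smul, map_smul]
  refine Finset.sum_congr rfl fun m _ => ?_
  rw [Finset.prod_mul_distrib, ← gammaProdMoment_xPow, xPow, smul_eq_mul]

lemma gammaProdMoment_X_mul_xPow {d : ℕ} (β : Fin d → ℝ) (s : ℝ) (i : Fin d) (m : Fin d → ℕ) :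
    gammaProdMoment β s (MvPolynomial.X i * xPow m) =
      s * (β i + m i) * gammaProdMoment β s (xPow m) := by
  classical
  have h : MvPolynomial.X i * xPow m = xPow (Function.update m i (m i + 1)) := by
    rw [xPow, xPow, ← Finset.mul_prod_erase _ _ (Finset.mem_univ i),
      ← Finset.mul_prod_erase _ (fun j => MvPolynomial.X j ^ (Function.update m i (m i + 1)) j)
        (Finset.mem_univ i), Function.update_self, pow_succ', mul_assoc]
    congr 2
    refine Finset.prod_congr rfl fun j hj => ?_
    rw [Function.update_of_ne (Finset.ne_of_mem_erase hj)]
  rw [h, gammaProdMoment_xPow, gammaProdMoment_xPow,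
    ← Finset.mul_prod_erase _ _ (Finset.mem_univ i),
    ← Finset.mul_prod_erase _ (fun j => s ^ m j * rising (β j) (m j)) (Finset.mem_univ i),
    Function.update_self, rising_succ]
  rw [Finset.prod_congr rfl fun j hj => by
    rw [Function.update_of_ne (Finset.ne_of_mem_erase hj)]]
  ring

/-- Multiplying a monomial by `X i` multiplies its moment by `s * (β i + m i)`. Summed over `i`,
these factors depend on the monomial only through its degree. -/
lemma gammaProdMoment_xSum_mul {d : ℕ} (β : Fin d → ℝ) (s : ℝ) {M : ℕ}
    {F : MvPolynomial (Fin d) ℝ} (hF : F.IsHomogeneous M) :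
    gammaProdMoment β s (xSum d * F) = s * ((∑ i, β i) + M) * gammaProdMoment β s F := by
  refine linearMap_eq_of_isHomogeneous
    (L₁ := (gammaProdMoment β s) ∘ₗ LinearMap.mulLeft ℝ (xSum d))
    (L₂ := (s * ((∑ i, β i) + M)) • gammaProdMoment β s) (fun m hm => ?_) hF
  simp only [LinearMap.comp_apply, LinearMap.mulLeft_apply, LinearMap.smul_apply, smul_eq_mul,
    xSum, Finset.sum_mul, map_sum, gammaProdMoment_X_mul_xPow]
  rw [← Finset.sum_mul, ← Finset.mul_sum, Finset.sum_add_distrib, ← hm]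
  push_cast; rfl

lemma gammaProdMoment_xSum_pow_mul {d : ℕ} (β : Fin d → ℝ) (s : ℝ) {M : ℕ}
    {F : MvPolynomial (Fin d) ℝ} (hF : F.IsHomogeneous M) (j : ℕ) :
    gammaProdMoment β s (xSum d ^ j * F) =
      s ^ j * rising ((∑ i, β i) + M) j * gammaProdMoment β s F := by
  induction j with
  | zero => simp
  | succ j ih =>
    have h : (xSum d ^ j * F).IsHomogeneous (j + M) := by
      simpa using ((isHomogeneous_xSum d).pow j).mul hF
    rw [pow_succ', mul_assoc, gammaProdMoment_xSum_mul β s h, ih, rising_succ]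
    push_cast; ring

/-- Algebraic form of the independence of `|Y|` and `Y / |Y|`: weighting by a homogeneous `F` of
degree `M` raises the shape of `|Y|` by `M`, whatever `F` is. -/
lemma gammaProdMoment_aeval_xSum_mul {d : ℕ} (β : Fin d → ℝ) (s : ℝ) {M : ℕ}
    {F : MvPolynomial (Fin d) ℝ} (hF : F.IsHomogeneous M) (q : Polynomial ℝ) :
    gammaProdMoment β s (Polynomial.aeval (xSum d) q * F) =
      gammaMoment ((∑ i, β i) + M) s q * gammaProdMoment β s F := by
  conv_rhs => rw [q.as_sum_range]
  rw [Polynomial.aeval_eq_sum_range, Finset.sum_mul, map_sum, map_sum, Finset.sum_mul]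
  refine Finset.sum_congr rfl fun j _ => ?_
  rw [smul_mul_assoc, map_smul, gammaProdMoment_xSum_pow_mul β s hF, gammaMoment_monomial,
    smul_eq_mul]
  ring

lemma gammaProdMoment_scale {d : ℕ} (β : Fin d → ℝ) (s : ℝ) {M : ℕ}
    {F : MvPolynomial (Fin d) ℝ} (hF : F.IsHomogeneous M) :
    gammaProdMoment β s F = s ^ M * gammaProdMoment β 1 F := by
  refine linearMap_eq_of_isHomogeneous (L₁ := gammaProdMoment β s)
    (L₂ := s ^ M • gammaProdMoment β 1) (fun m hm => ?_) hF
  rw [LinearMap.smul_apply, gammaProdMoment_xPow, gammaProdMoment_xPow, Finset.prod_mul_distrib,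
    Finset.prod_pow_eq_pow_sum, hm]
  simp

lemma xPow_succ {d : ℕ} (m : Fin (d + 1) → ℕ) :
    xPow m = MvPolynomial.X 0 ^ m 0 * MvPolynomial.rename Fin.succ (xPow fun i => m i.succ) := by
  simp [xPow, Fin.prod_univ_succ, map_prod]

lemma gammaProdMoment_X_zero_pow_mul_rename {d : ℕ} (β : Fin (d + 1) → ℝ) (s : ℝ) (i : ℕ)
    (F : MvPolynomial (Fin d) ℝ) :
    gammaProdMoment β s (MvPolynomial.X 0 ^ i * MvPolynomial.rename Fin.succ F) =
      s ^ i * rising (β 0) i * gammaProdMoment (fun j => β j.succ) s F := by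
  have := linearMap_ext_xPow
    (L₁ := (gammaProdMoment β s) ∘ₗ (LinearMap.mulLeft ℝ (MvPolynomial.X 0 ^ i)) ∘ₗ
      (MvPolynomial.rename (R := ℝ) (Fin.succ : Fin d → Fin (d + 1))).toLinearMap)
    (L₂ := (s ^ i * rising (β 0) i) • gammaProdMoment (fun j => β j.succ) s) fun m => by
      have h := xPow_succ (Fin.cons i m : Fin (d + 1) → ℕ)
      simp only [Fin.cons_zero, Fin.cons_succ] at h
      simp only [LinearMap.comp_apply, AlgHom.toLinearMap_apply, LinearMap.mulLeft_apply,
        LinearMap.smul_apply, ← h, gammaProdMoment_xPow, Fin.prod_univ_succ, Fin.cons_zero,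
        Fin.cons_succ, smul_eq_mul]
  exact LinearMap.congr_fun this F

/-- A polynomial in the first variable and in the sum of the other variables may be integrated
separately from a homogeneous polynomial in the other variables. -/
lemma gammaProdMoment_aeval_mul_rename {d : ℕ} (β : Fin (d + 1) → ℝ) {M : ℕ}
    {F : MvPolynomial (Fin d) ℝ} (hF : F.IsHomogeneous M) (P : MvPolynomial (Fin 2) ℝ) :
    gammaProdMoment β 1 (MvPolynomial.aeval
        ![MvPolynomial.X 0, MvPolynomial.rename Fin.succ (xSum d)] P *
          MvPolynomial.rename Fin.succ F) =
      gammaProdMoment ![β 0, (∑ i : Fin d, β i.succ) + M] 1 P *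
        gammaProdMoment (fun j => β j.succ) 1 F := by
  have := linearMap_ext_xPow
    (L₁ := (gammaProdMoment β 1) ∘ₗ
      (LinearMap.mulRight ℝ (MvPolynomial.rename Fin.succ F)) ∘ₗ
      (MvPolynomial.aeval (R := ℝ)
        ![MvPolynomial.X 0, MvPolynomial.rename Fin.succ (xSum d)]).toLinearMap)
    (L₂ := gammaProdMoment (fun j => β j.succ) 1 F •
      gammaProdMoment ![β 0, (∑ i : Fin d, β i.succ) + M] 1) fun m => by
      simp only [LinearMap.comp_apply, AlgHom.toLinearMap_apply, LinearMap.mulRight_apply,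
        LinearMap.smul_apply, gammaProdMoment_xPow, Fin.prod_univ_two, smul_eq_mul]
      simp only [xPow, map_mul, map_pow, MvPolynomial.aeval_X, Fin.prod_univ_two,
        Matrix.cons_val_zero, Matrix.cons_val_one]
      rw [mul_assoc, ← map_pow, ← map_mul, gammaProdMoment_X_zero_pow_mul_rename,
        gammaProdMoment_xSum_pow_mul _ _ hF]
      ring
  rw [mul_comm (gammaProdMoment _ _ P)]
  exact LinearMap.congr_fun this P

/-! ### Homogeneous Jacobi polynomials -/

/-- The homogeneous form `(u + v) ^ n * R_n^{a,b}(u / (u + v))` of the Jacobi polynomials. -/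
def jacobiHom {A : Type*} [CommRing A] [Algebra ℝ A] (a b : ℝ) (n : ℕ) (u v : A) : A :=
  ∑ k ∈ Finset.range (n + 1),
    (rising (-(n : ℝ)) k * rising (n + a + b - 1) k / (rising b k * k.factorial)) •
      (v ^ k * (u + v) ^ (n - k))

lemma map_jacobiHom {A B : Type*} [CommRing A] [Algebra ℝ A] [CommRing B] [Algebra ℝ B]
    (f : A →ₐ[ℝ] B) (a b : ℝ) (n : ℕ) (u v : A) :
    f (jacobiHom a b n u v) = jacobiHom a b n (f u) (f v) := by
  simp [jacobiHom, map_sum, map_smul]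

lemma isHomogeneous_jacobiHom {d : ℕ} (a b : ℝ) (n : ℕ) {u v : MvPolynomial (Fin d) ℝ}
    (hu : u.IsHomogeneous 1) (hv : v.IsHomogeneous 1) : (jacobiHom a b n u v).IsHomogeneous n := by
  refine MvPolynomial.IsHomogeneous.sum _ _ _ fun k hk => ?_
  rw [MvPolynomial.smul_eq_C_mul]
  refine MvPolynomial.IsHomogeneous.C_mul ?_ _
  have := (hv.pow k).mul ((hu.add hv).pow (n - k))
  rwa [one_mul, one_mul, Nat.add_sub_cancel' (Nat.lt_succ_iff.1 (Finset.mem_range.1 hk))] at this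

lemma jacobiHom_zero_right {A : Type*} [CommRing A] [Algebra ℝ A] (a b : ℝ) (n : ℕ) (u : A) :
    jacobiHom a b n u 0 = u ^ n := by
  rw [jacobiHom, Finset.sum_eq_single_of_mem 0 (by simp)]
  · simp
  · intro k _ hk; simp [hk]

/-- Orthogonality of the Jacobi polynomials to polynomials of lower degree. -/
lemma gammaProdMoment_jacobiHom_mul_eq_zero {a b : ℝ} (ha : 0 < a) (hb : 0 < b) {n i e : ℕ}
    (h : i + e < n) :
    gammaProdMoment ![a, b + e] 1 (jacobiHom a b n (MvPolynomial.X 0) (MvPolynomial.X 1) *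
      MvPolynomial.X 0 ^ i) = 0 := by
  obtain ⟨t, rfl⟩ := Nat.exists_eq_add_of_lt h
  -- The choice of `c` gives `n + a + b - 1 = c + t`, and integrating the `k`-th term produces `(c +
  -- k)_{n-k} = (c)_n / (c)_k`. The quotients `(b + e)_k / (b)_k` and `(c + t)_k / (c)_k` become `(b
  -- + k)_e / (b)_e` and `(c + k)_t / (c)_t`. What remains is an alternating binomial sum of the
  -- polynomial `q` in `k`, of degree at most `e + t < n`.
  set c : ℝ := a + b + e + i with hc
  have hc0 : 0 < c := by positivity
  set q : Polynomial ℝ := (ascPochhammer ℝ e).comp (Polynomial.X + Polynomial.C b) *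
    (ascPochhammer ℝ t).comp (Polynomial.X + Polynomial.C c) with hq
  have hqd : q.natDegree < i + e + t + 1 := by
    refine lt_of_le_of_lt Polynomial.natDegree_mul_le ?_
    rw [natDegree_ascPochhammer_comp, natDegree_ascPochhammer_comp]; omega
  have key := sum_alternating_choose_eval_eq_zero hqd
  set n := i + e + t + 1 with hn
  have hcn : (n : ℝ) + a + b - 1 = c + t := by rw [hc, hn]; push_cast; ring
  have term : ∀ k ∈ Finset.range (n + 1),
      gammaProdMoment ![a, b + e] 1
        ((rising (-(n : ℝ)) k * rising (n + a + b - 1) k / (rising b k * k.factorial)) •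
          (MvPolynomial.X 1 ^ k * (MvPolynomial.X 0 + MvPolynomial.X 1) ^ (n - k)) *
          MvPolynomial.X 0 ^ i) =
      (rising a i * rising c n / (rising b e * rising c t)) *
        ((-1 : ℝ) ^ k * n.choose k * q.eval (k : ℝ)) := by
    intro k hk
    have hkn : k ≤ n := Nat.lt_succ_iff.1 (Finset.mem_range.1 hk)
    have h1 : (MvPolynomial.X 1 ^ k * (MvPolynomial.X 0 + MvPolynomial.X 1) ^ (n - k)) *
        MvPolynomial.X 0 ^ i = xSum 2 ^ (n - k) * xPow ![i, k] := by
      simp [xSum, xPow, Fin.sum_univ_two, Fin.prod_univ_two]; ring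
    have hom := isHomogeneous_xPow ![i, k]
    rw [smul_mul_assoc, map_smul, h1, gammaProdMoment_xSum_pow_mul _ _ hom, gammaProdMoment_xPow,
      hcn, smul_eq_mul, hq, Polynomial.eval_mul, eval_ascPochhammer_comp, eval_ascPochhammer_comp]
    simp only [Fin.sum_univ_two, Fin.prod_univ_two, Matrix.cons_val_zero, Matrix.cons_val_one,
      one_pow, one_mul]
    rw [show a + (b + (e : ℝ)) + ((i + k : ℕ) : ℝ) = c + k by rw [hc]; push_cast; ring]
    rw [mul_comm (rising b k), mul_comm (rising (-(n : ℝ)) k), rising_neg_natCast]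
    have e1 : rising c n = rising c k * rising (c + k) (n - k) := by
      rw [← rising_add, Nat.add_sub_cancel' hkn]
    have e2 : rising c k * rising (c + k) t = rising c t * rising (c + t) k := by
      rw [← rising_add, ← rising_add, add_comm]
    have e3 : rising b e * rising (b + e) k = rising b k * rising (b + k) e := by
      rw [← rising_add, ← rising_add, add_comm]
    have := (rising_pos hb e).ne'
    have := (rising_pos hb k).ne'
    have := (rising_pos hc0 t).ne'
    have := (rising_pos hc0 k).ne'
    have hf : (k.factorial : ℝ) ≠ 0 := by positivity
    have e4 : rising (b + e) k = rising b k * rising (b + k) e / rising b e := by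
      field_simp; linarith
    have e5 : rising (c + t) k = rising c k * rising (c + k) t / rising c t := by
      field_simp; linarith
    rw [e1, e4, e5]
    field_simp
  rw [jacobiHom, Finset.sum_mul, map_sum, Finset.sum_congr rfl term, ← Finset.mul_sum, key,
    mul_zero]

/-- The homogeneous form of the Jacobi polynomials on the simplex. -/
def jacobiSimplexPoly {k : ℕ} (α : Fin (k + 1) → ℝ) (l : Fin k → ℕ) :
    MvPolynomial (Fin (k + 1)) ℝ :=
  ∏ j : Fin k, jacobiHom (α j.castSucc)
    ((∑ i ∈ Finset.Ioi j.castSucc, α i) + 2 * ((∑ i ∈ Finset.Ioi j, l i : ℕ) : ℝ)) (l j)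
    (MvPolynomial.X j.castSucc) (∑ i ∈ Finset.Ioi j.castSucc, MvPolynomial.X i)

lemma isHomogeneous_jacobiSimplexPoly {k : ℕ} (α : Fin (k + 1) → ℝ) (l : Fin k → ℕ) :
    (jacobiSimplexPoly α l).IsHomogeneous (∑ i, l i) :=
  MvPolynomial.IsHomogeneous.prod _ _ _ fun _ _ => isHomogeneous_jacobiHom _ _ _
    (MvPolynomial.isHomogeneous_X ℝ _)
    (MvPolynomial.IsHomogeneous.sum _ _ _ fun i _ => MvPolynomial.isHomogeneous_X ℝ i)

/-- Basis of the inductions on the dimension: the first factor sees the other variables only through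
their sum, and the remaining factors form the same polynomial in one variable fewer. -/
lemma jacobiSimplexPoly_succ {k : ℕ} (α : Fin (k + 2) → ℝ) (l : Fin (k + 1) → ℕ) :
    jacobiSimplexPoly α l =
      MvPolynomial.aeval ![MvPolynomial.X 0, MvPolynomial.rename Fin.succ (xSum (k + 1))]
        (jacobiHom (α 0) ((∑ i : Fin (k + 1), α i.succ) + 2 * ((∑ i : Fin k, l i.succ : ℕ) : ℝ))
          (l 0) (MvPolynomial.X 0 : MvPolynomial (Fin 2) ℝ) (MvPolynomial.X 1)) *
        MvPolynomial.rename Fin.succ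
          (jacobiSimplexPoly (fun i => α i.succ) (fun i => l i.succ)) := by
  rw [jacobiSimplexPoly, Fin.prod_univ_succ, map_jacobiHom, jacobiSimplexPoly, map_prod]
  congr 1
  · simp only [Fin.castSucc_zero, Fin.sum_Ioi_zero, MvPolynomial.aeval_X, xSum, map_sum,
      MvPolynomial.rename_X, Matrix.cons_val_zero, Matrix.cons_val_one]
  · refine Finset.prod_congr rfl fun j _ => ?_
    rw [map_jacobiHom]
    simp only [Fin.castSucc_succ, Fin.sum_Ioi_succ, map_sum, MvPolynomial.rename_X]

lemma jacobiSimplexPoly_ne_zero {k : ℕ} (α : Fin (k + 1) → ℝ) (l : Fin k → ℕ) :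
    jacobiSimplexPoly α l ≠ 0 := by
  induction k with
  | zero => simp [jacobiSimplexPoly]
  | succ k ih =>
    rw [jacobiSimplexPoly_succ]
    refine mul_ne_zero ?_ fun h => ih _ _
      (MvPolynomial.rename_injective _ (Fin.succ_injective _) (h.trans (map_zero _).symm))
    intro h
    -- At the vertex `(1, 0, …, 0)` the first factor equals `1`.
    have h2 := congrArg (MvPolynomial.aeval (Fin.cons 1 0 : Fin (k + 2) → ℝ)) h
    rw [map_jacobiHom, map_jacobiHom, map_zero] at h2
    simp only [MvPolynomial.aeval_X, Matrix.cons_val_zero, Matrix.cons_val_one, xSum, map_sum,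
      MvPolynomial.rename_X, Fin.cons_zero, Fin.cons_succ, Pi.zero_apply, Finset.sum_const_zero,
      jacobiHom_zero_right] at h2
    simp at h2

/-- Let `N` and `M` be the parts of `|l|` and `|m|` beyond the first coordinate. If `M < N`,
induction annihilates the factor in the other variables. If `M = N + e`, that factor has degree `2 N
+ e` and gives the sum of the other variables the shape `A + 2 N + e`. This is the Jacobi parameter
`A + 2 N` shifted by `e`, and `m 0 + e < l 0`, so the one-dimensional orthogonality applies. -/
lemma gammaProdMoment_jacobiSimplexPoly_mul_xPow {k : ℕ} {α : Fin (k + 1) → ℝ}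
    (hα : ∀ i, 0 < α i) {l : Fin k → ℕ} {m : Fin (k + 1) → ℕ} (h : ∑ i, m i < ∑ i, l i) :
    gammaProdMoment α 1 (jacobiSimplexPoly α l * xPow m) = 0 := by
  induction k with
  | zero => simp at h
  | succ k ih =>
    set N := ∑ i : Fin k, l i.succ with hN
    set M := ∑ i : Fin (k + 1), m i.succ with hM
    have hom : (jacobiSimplexPoly (fun i => α i.succ) (fun i => l i.succ) *
        xPow fun i => m i.succ).IsHomogeneous (N + M) :=
      (isHomogeneous_jacobiSimplexPoly _ _).mul (isHomogeneous_xPow _)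
    have hX : (MvPolynomial.X 0 : MvPolynomial (Fin (k + 2)) ℝ) ^ m 0 = MvPolynomial.aeval
        ![MvPolynomial.X 0, MvPolynomial.rename Fin.succ (xSum (k + 1))]
        ((MvPolynomial.X 0 : MvPolynomial (Fin 2) ℝ) ^ m 0) := by simp
    rw [jacobiSimplexPoly_succ, xPow_succ, mul_mul_mul_comm, ← map_mul, hX, ← map_mul,
      gammaProdMoment_aeval_mul_rename α hom]
    rcases lt_or_ge M N with hlt | hge
    · rw [ih (fun i => hα i.succ) hlt, mul_zero]
    · obtain ⟨e, he⟩ := Nat.exists_eq_add_of_le hge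
      rw [Fin.sum_univ_succ m, Fin.sum_univ_succ l, ← hN, ← hM] at h
      have hpos : 0 < ∑ i : Fin (k + 1), α i.succ :=
        Finset.sum_pos (fun i _ => hα i.succ) Finset.univ_nonempty
      rw [show (∑ i : Fin (k + 1), α i.succ) + ((N + M : ℕ) : ℝ) =
        (∑ i : Fin (k + 1), α i.succ) + 2 * (N : ℝ) + (e : ℝ) by rw [he]; push_cast; ring]
      rw [gammaProdMoment_jacobiHom_mul_eq_zero (hα 0) (by positivity) (by omega), zero_mul]

lemma gammaProdMoment_jacobiSimplexPoly_mul_of_lt {k M : ℕ} {α : Fin (k + 1) → ℝ}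
    (hα : ∀ i, 0 < α i) {l : Fin k → ℕ} {F : MvPolynomial (Fin (k + 1)) ℝ}
    (hF : F.IsHomogeneous M) (h : M < ∑ i, l i) :
    gammaProdMoment α 1 (jacobiSimplexPoly α l * F) = 0 :=
  linearMap_eq_of_isHomogeneous
    (L₁ := gammaProdMoment α 1 ∘ₗ LinearMap.mulLeft ℝ (jacobiSimplexPoly α l)) (L₂ := 0)
    (fun _ hm => gammaProdMoment_jacobiSimplexPoly_mul_xPow hα (hm ▸ h)) hF

lemma gammaProdMoment_jacobiSimplexPoly_mul_of_ne {k : ℕ} {α : Fin (k + 1) → ℝ}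
    (hα : ∀ i, 0 < α i) {l m : Fin k → ℕ} (h : l ≠ m) :
    gammaProdMoment α 1 (jacobiSimplexPoly α l * jacobiSimplexPoly α m) = 0 := by
  induction k with
  | zero => exact absurd (Subsingleton.elim _ _) h
  | succ k ih =>
    rcases lt_trichotomy (∑ i, l i) (∑ i, m i) with hlt | heq | hgt
    · rw [mul_comm]
      exact gammaProdMoment_jacobiSimplexPoly_mul_of_lt hα (isHomogeneous_jacobiSimplexPoly _ _) hlt
    -- With equal total degrees the tails must differ, since equal tails would force equal first
    -- indices.
    · have h' : (fun i : Fin k => l i.succ) ≠ fun i => m i.succ := by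
        intro h2
        refine h (funext fun i => ?_)
        rw [Fin.sum_univ_succ, Fin.sum_univ_succ, show ∑ i : Fin k, l i.succ = ∑ i : Fin k, m i.succ
          from Finset.sum_congr rfl fun i _ => congrFun h2 i] at heq
        induction i using Fin.cases with
        | zero => omega
        | succ i => exact congrFun h2 i
      rw [jacobiSimplexPoly_succ, jacobiSimplexPoly_succ, mul_mul_mul_comm, ← map_mul, ← map_mul,
        gammaProdMoment_aeval_mul_rename α ((isHomogeneous_jacobiSimplexPoly _ _).mul
          (isHomogeneous_jacobiSimplexPoly _ _)), ih (fun i => hα i.succ) h', mul_zero]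
    · exact gammaProdMoment_jacobiSimplexPoly_mul_of_lt hα (isHomogeneous_jacobiSimplexPoly _ _) hgt

/-! ### The two Laguerre systems as polynomials -/

/-- `P` is orthogonal to the monomials of degree less than `N` for the product Gamma weight. -/
def OrthogonalBelow {d : ℕ} (α : Fin d → ℝ) (N : ℕ) (P : MvPolynomial (Fin d) ℝ) : Prop :=
  ∀ m : Fin d → ℕ, ∑ i, m i < N → gammaProdMoment α 1 (P * xPow m) = 0

lemma OrthogonalBelow.mul_eq_zero {d N : ℕ} {α : Fin d → ℝ} {P Q : MvPolynomial (Fin d) ℝ}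
    (h : OrthogonalBelow α N P) (hQ : Q.totalDegree < N) : gammaProdMoment α 1 (P * Q) = 0 :=
  linearMap_eq_of_totalDegree_le
    (L₁ := gammaProdMoment α 1 ∘ₗ LinearMap.mulLeft ℝ P) (L₂ := 0)
    (fun _ hm => h _ (lt_of_le_of_lt hm hQ)) le_rfl

lemma gammaMoment_laguerrePoly_mul_X_pow_eq_zero {a : ℝ} (ha : 0 < a) {n l : ℕ} (hl : l < n) :
    gammaMoment a 1 (laguerrePoly a n * Polynomial.X ^ l) = 0 := by
  rw [laguerrePoly, ← Polynomial.smul_eq_C_mul, smul_mul_assoc, map_smul,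
    gammaMoment_kummerPoly_mul_X_pow_eq_zero ha hl, smul_zero]

lemma gammaMoment_laguerrePoly_mul {a : ℝ} (ha : 0 < a) (n m : ℕ) :
    gammaMoment a 1 (laguerrePoly a n * laguerrePoly a m) =
      if n = m then rising a n / n.factorial else 0 := by
  rw [laguerrePoly, laguerrePoly, ← Polynomial.smul_eq_C_mul, ← Polynomial.smul_eq_C_mul,
    smul_mul_smul_comm, map_smul, gammaMoment_kummerPoly_mul_kummerPoly ha, smul_eq_mul]
  split_ifs with h
  · subst h
    have := (rising_pos ha n).ne'
    have hf : (n.factorial : ℝ) ≠ 0 := by positivity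
    field_simp
  · simp

lemma gammaMoment_mul_X_pow (a s : ℝ) (q : Polynomial ℝ) (e : ℕ) :
    gammaMoment a s (q * Polynomial.X ^ e) =
      s ^ e * rising a e * gammaMoment (a + e) s q := by
  conv_lhs => rw [q.as_sum_range]
  conv_rhs => rw [q.as_sum_range]
  simp only [Finset.sum_mul, map_sum, Polynomial.monomial_mul_X_pow, gammaMoment_monomial,
    Finset.mul_sum]
  refine Finset.sum_congr rfl fun k _ => ?_
  rw [add_comm k e, rising_add]; ring

/-- The product Laguerre system as polynomials. -/
def laguerreProdPoly {d : ℕ} (α : Fin d → ℝ) (n : Fin d → ℕ) : MvPolynomial (Fin d) ℝ :=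
  ∏ i, Polynomial.aeval (MvPolynomial.X i) (laguerrePoly (α i) (n i))

/-- The multiple Laguerre system as polynomials. -/
def laguerreStarPoly {k : ℕ} (α : Fin (k + 1) → ℝ) (n : Fin (k + 1) → ℕ) :
    MvPolynomial (Fin (k + 1)) ℝ :=
  Polynomial.aeval (xSum (k + 1))
      (laguerrePoly ((∑ i, α i) + 2 * ((∑ i : Fin k, n i.castSucc : ℕ) : ℝ)) (n (Fin.last k))) *
    jacobiSimplexPoly α fun i => n i.castSucc

lemma totalDegree_aeval_le {d : ℕ} {x : MvPolynomial (Fin d) ℝ} (hx : x.totalDegree ≤ 1)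
    {q : Polynomial ℝ} {n : ℕ} (hq : q.natDegree ≤ n) :
    (Polynomial.aeval x q).totalDegree ≤ n := by
  rw [Polynomial.aeval_eq_sum_range]
  refine MvPolynomial.totalDegree_finsetSum_le fun j hj => ?_
  refine (MvPolynomial.totalDegree_smul_le _ _).trans ((MvPolynomial.totalDegree_pow _ _).trans ?_)
  have := Finset.mem_range.1 hj
  calc j * x.totalDegree ≤ j * 1 := Nat.mul_le_mul_left _ hx
    _ ≤ n := by omega

lemma totalDegree_prod_aeval_le {d : ℕ} {q : Fin d → Polynomial ℝ} {n : Fin d → ℕ}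
    (hq : ∀ i, (q i).natDegree ≤ n i) :
    (∏ i, Polynomial.aeval (MvPolynomial.X i : MvPolynomial (Fin d) ℝ) (q i)).totalDegree ≤
      ∑ i, n i :=
  (MvPolynomial.totalDegree_finsetProd _ _).trans
    (Finset.sum_le_sum fun i _ => totalDegree_aeval_le (by simp) (hq i))

lemma totalDegree_laguerreProdPoly_le {d : ℕ} (α : Fin d → ℝ) (n : Fin d → ℕ) :
    (laguerreProdPoly α n).totalDegree ≤ ∑ i, n i :=
  totalDegree_prod_aeval_le fun i => natDegree_laguerrePoly_le (α i) (n i)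

lemma totalDegree_laguerreStarPoly_le {k : ℕ} (α : Fin (k + 1) → ℝ) (n : Fin (k + 1) → ℕ) :
    (laguerreStarPoly α n).totalDegree ≤ ∑ i, n i := by
  refine (MvPolynomial.totalDegree_mul _ _).trans ?_
  rw [Fin.sum_univ_castSucc n, add_comm]
  exact add_le_add (isHomogeneous_jacobiSimplexPoly _ _).totalDegree_le
    (totalDegree_aeval_le (isHomogeneous_xSum _).totalDegree_le (natDegree_laguerrePoly_le _ _))

lemma gammaProdMoment_laguerreProdPoly_mul {d : ℕ} {α : Fin d → ℝ} (hα : ∀ i, 0 < α i)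
    (n m : Fin d → ℕ) :
    gammaProdMoment α 1 (laguerreProdPoly α n * laguerreProdPoly α m) =
      if n = m then (laguerrePhi α n)⁻¹ else 0 := by
  rw [laguerreProdPoly, laguerreProdPoly, ← Finset.prod_mul_distrib]
  simp only [← map_mul]
  rw [gammaProdMoment_prod_aeval α 1]
  simp only [gammaMoment_laguerrePoly_mul (hα _), laguerrePhi, inv_inv]
  split_ifs with h
  · subst h; simp
  · obtain ⟨i, hi⟩ := Function.ne_iff.1 h
    exact Finset.prod_eq_zero (Finset.mem_univ i) (if_neg hi)

lemma orthogonalBelow_laguerreProdPoly {d : ℕ} {α : Fin d → ℝ} (hα : ∀ i, 0 < α i)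
    (n : Fin d → ℕ) : OrthogonalBelow α (∑ i, n i) (laguerreProdPoly α n) := by
  intro m hm
  obtain ⟨i, _, hi⟩ := Finset.exists_lt_of_sum_lt hm
  have h : laguerreProdPoly α n * xPow m = ∏ i, Polynomial.aeval (MvPolynomial.X i)
      (laguerrePoly (α i) (n i) * Polynomial.X ^ m i) := by
    rw [laguerreProdPoly, xPow, ← Finset.prod_mul_distrib]
    simp
  rw [h, gammaProdMoment_prod_aeval α 1]
  exact Finset.prod_eq_zero (Finset.mem_univ i)
    (gammaMoment_laguerrePoly_mul_X_pow_eq_zero (hα i) hi)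

lemma laguerrePhi_pos {d : ℕ} {α : Fin d → ℝ} (hα : ∀ i, 0 < α i) (n : Fin d → ℕ) :
    0 < laguerrePhi α n :=
  inv_pos.2 (Finset.prod_pos fun i _ => div_pos (rising_pos (hα i) _) (by positivity))

lemma sum_pos_of_pos {k : ℕ} {α : Fin (k + 1) → ℝ} (hα : ∀ i, 0 < α i) : 0 < ∑ i, α i :=
  Finset.sum_pos (fun i _ => hα i) Finset.univ_nonempty

/-- Same dichotomy as for the simplex. If `|m| < N`, the Jacobi factor annihilates the monomial. If
`|m| = N + e`, the homogeneous part has degree `2 N + e`, so the Laguerre factor of parameter `|α| +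
2 N` is in effect paired with `X ^ e`, where `e < n_d`. -/
lemma orthogonalBelow_laguerreStarPoly {k : ℕ} {α : Fin (k + 1) → ℝ} (hα : ∀ i, 0 < α i)
    (n : Fin (k + 1) → ℕ) : OrthogonalBelow α (∑ i, n i) (laguerreStarPoly α n) := by
  intro m hm
  set N := ∑ i : Fin k, n i.castSucc with hN
  rw [laguerreStarPoly, mul_assoc, gammaProdMoment_aeval_xSum_mul α 1
    ((isHomogeneous_jacobiSimplexPoly _ _).mul (isHomogeneous_xPow m)), ← hN]
  rcases lt_or_ge (∑ i, m i) N with hlt | hge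
  · rw [gammaProdMoment_jacobiSimplexPoly_mul_xPow hα hlt, mul_zero]
  · obtain ⟨e, he⟩ := Nat.exists_eq_add_of_le hge
    rw [Fin.sum_univ_castSucc n, ← hN, he] at hm
    have hb : 0 < (∑ i, α i) + 2 * (N : ℝ) := by have := sum_pos_of_pos hα; positivity
    have h := gammaMoment_laguerrePoly_mul_X_pow_eq_zero hb (n := n (Fin.last k)) (l := e)
      (by omega)
    rw [gammaMoment_mul_X_pow, one_pow, one_mul] at h
    rw [he, show (∑ i, α i) + ((N + (N + e) : ℕ) : ℝ) = (∑ i, α i) + 2 * (N : ℝ) + e by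
      push_cast; ring, (mul_eq_zero.1 h).resolve_left (rising_pos hb e).ne', zero_mul]

lemma gammaProdMoment_laguerreStarPoly_mul_of_ne {k : ℕ} {α : Fin (k + 1) → ℝ}
    (hα : ∀ i, 0 < α i) {n m : Fin (k + 1) → ℕ} (h : n ≠ m) :
    gammaProdMoment α 1 (laguerreStarPoly α n * laguerreStarPoly α m) = 0 := by
  rcases lt_trichotomy (∑ i, n i) (∑ i, m i) with hlt | heq | hgt
  · rw [mul_comm]
    exact (orthogonalBelow_laguerreStarPoly hα m).mul_eq_zero
      ((totalDegree_laguerreStarPoly_le α n).trans_lt hlt)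
  · have h' : (fun i : Fin k => n i.castSucc) ≠ fun i => m i.castSucc := by
      intro h2
      refine h (funext fun i => ?_)
      rw [Fin.sum_univ_castSucc, Fin.sum_univ_castSucc,
        show ∑ i : Fin k, n i.castSucc = ∑ i : Fin k, m i.castSucc
          from Finset.sum_congr rfl fun i _ => congrFun h2 i] at heq
      induction i using Fin.lastCases with
      | last => omega
      | cast i => exact congrFun h2 i
    rw [laguerreStarPoly, laguerreStarPoly, mul_mul_mul_comm, ← map_mul,
      gammaProdMoment_aeval_xSum_mul α 1 ((isHomogeneous_jacobiSimplexPoly _ _).mul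
        (isHomogeneous_jacobiSimplexPoly _ _)),
      gammaProdMoment_jacobiSimplexPoly_mul_of_ne hα h', mul_zero]
  · exact (orthogonalBelow_laguerreStarPoly hα n).mul_eq_zero
      ((totalDegree_laguerreStarPoly_le α m).trans_lt hgt)

lemma laguerreStarPoly_ne_zero {k : ℕ} {α : Fin (k + 1) → ℝ} (hα : ∀ i, 0 < α i)
    (n : Fin (k + 1) → ℕ) : laguerreStarPoly α n ≠ 0 := by
  refine mul_ne_zero (fun h => ?_) (jacobiSimplexPoly_ne_zero _ _)
  have hb : 0 < (∑ i, α i) + 2 * ((∑ i : Fin k, n i.castSucc : ℕ) : ℝ) := by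
    have := sum_pos_of_pos hα; positivity
  -- At the origin only the constant term of the Laguerre factor survives, and it is nonzero.
  have h2 := congrArg (MvPolynomial.aeval (0 : Fin (k + 1) → ℝ)) h
  rw [← Polynomial.aeval_algHom_apply, map_zero] at h2
  simp only [xSum, map_sum, MvPolynomial.aeval_X, Pi.zero_apply, Finset.sum_const_zero] at h2
  rw [Polynomial.coe_aeval_eq_eval, laguerrePoly, Polynomial.eval_mul, Polynomial.eval_C,
    ← Polynomial.coeff_zero_eq_eval_zero, coeff_kummerPoly] at h2
  have := (rising_pos hb (n (Fin.last k))).ne'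
  have hf : ((n (Fin.last k)).factorial : ℝ) ≠ 0 := by positivity
  rw [pow_zero, one_mul, Nat.choose_zero_right, Nat.cast_one, rising_zero, div_one, mul_one] at h2
  exact div_ne_zero this hf h2

/-! ### Expansion in the product Laguerre system -/

/-- The multi-indices of total degree at most `N`. -/
def indicesLE (d N : ℕ) : Finset (Fin d → ℕ) :=
  (Finset.range (N + 1)).biUnion fun j => Finset.piAntidiag Finset.univ j

lemma mem_indicesLE {d N : ℕ} {m : Fin d → ℕ} : m ∈ indicesLE d N ↔ ∑ i, m i ≤ N := by
  simp [indicesLE, Finset.mem_piAntidiag]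

lemma xPow_mem_span_laguerreProdPoly {d N : ℕ} {α : Fin d → ℝ} (hα : ∀ i, 0 < α i)
    {m : Fin d → ℕ} (hm : ∑ i, m i ≤ N) :
    xPow m ∈ Submodule.span ℝ (laguerreProdPoly α '' {m | ∑ i, m i ≤ N}) := by
  have h1 : ∀ i, (MvPolynomial.X i ^ m i : MvPolynomial (Fin d) ℝ) =
      ∑ j ∈ Finset.range (m i + 1), (rising (-(m i : ℝ)) j * rising (α i) (m i) / j.factorial *
        (rising (α i) j / j.factorial)⁻¹) • Polynomial.aeval (MvPolynomial.X i)
          (laguerrePoly (α i) j) := by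
    intro i
    have h := congrArg (Polynomial.aeval (MvPolynomial.X i : MvPolynomial (Fin d) ℝ))
      (X_pow_eq_sum_kummerPoly (hα i) (m i))
    rw [map_pow, Polynomial.aeval_X, map_sum] at h
    rw [h]
    refine Finset.sum_congr rfl fun j _ => ?_
    rw [laguerrePoly, ← map_smul, Polynomial.smul_eq_C_mul, ← mul_assoc, ← Polynomial.C_mul]
    congr 3
    have := (rising_pos (hα i) j).ne'
    have hf : (j.factorial : ℝ) ≠ 0 := by positivity
    field_simp
  rw [xPow, Finset.prod_congr rfl fun i _ => h1 i, Finset.prod_univ_sum]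
  refine Submodule.sum_mem _ fun j hj => ?_
  rw [Finset.prod_smul]
  refine Submodule.smul_mem _ _ (Submodule.subset_span ⟨j, ?_, rfl⟩)
  refine le_trans (Finset.sum_le_sum fun i _ => ?_) hm
  exact Nat.lt_succ_iff.1 (Finset.mem_range.1 (Fintype.mem_piFinset.1 hj i))

lemma eq_sum_laguerreProdPoly {d N : ℕ} {α : Fin d → ℝ} (hα : ∀ i, 0 < α i)
    {P : MvPolynomial (Fin d) ℝ} (hP : P.totalDegree ≤ N) :
    P = ∑ m ∈ indicesLE d N, (laguerrePhi α m *
      gammaProdMoment α 1 (P * laguerreProdPoly α m)) • laguerreProdPoly α m := by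
  -- `E` is the Fourier projection onto degree at most `N`. It fixes each product Laguerre
  -- polynomial in that range, and these span the monomials of degree at most `N`.
  set E : MvPolynomial (Fin d) ℝ →ₗ[ℝ] MvPolynomial (Fin d) ℝ :=
    ∑ m ∈ indicesLE d N, (laguerrePhi α m • (gammaProdMoment α 1 ∘ₗ
      LinearMap.mulRight ℝ (laguerreProdPoly α m))).smulRight (laguerreProdPoly α m) with hE
  have hEP : ∀ Q, E Q = ∑ m ∈ indicesLE d N, (laguerrePhi α m *
      gammaProdMoment α 1 (Q * laguerreProdPoly α m)) • laguerreProdPoly α m := by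
    intro Q; simp [hE, LinearMap.sum_apply]
  rw [← hEP]
  refine linearMap_eq_of_totalDegree_le (L₁ := LinearMap.id) (L₂ := E) (fun m hm => ?_) hP
  refine LinearMap.eqOn_span (s := laguerreProdPoly α '' {m | ∑ i, m i ≤ N}) ?_
    (xPow_mem_span_laguerreProdPoly hα hm)
  rintro _ ⟨j, hj, rfl⟩
  rw [hEP, Finset.sum_eq_single_of_mem j (mem_indicesLE.2 hj)]
  · rw [gammaProdMoment_laguerreProdPoly_mul hα, if_pos rfl,
      mul_inv_cancel₀ (laguerrePhi_pos hα j).ne', one_smul, LinearMap.id_apply]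
  · intro i _ hi
    rw [gammaProdMoment_laguerreProdPoly_mul hα, if_neg hi.symm, mul_zero, zero_smul]

/-- By Parseval the pairing is a sum of squares with the positive weights `laguerrePhi`, and it
vanishes only if every Fourier coefficient of `P` does. -/
lemma gammaProdMoment_mul_self_pos {d : ℕ} {α : Fin d → ℝ} (hα : ∀ i, 0 < α i)
    {P : MvPolynomial (Fin d) ℝ} (hP : P ≠ 0) : 0 < gammaProdMoment α 1 (P * P) := by
  have h := eq_sum_laguerreProdPoly hα (le_refl P.totalDegree)
  have h2 : gammaProdMoment α 1 (P * P) = ∑ m ∈ indicesLE d P.totalDegree,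
      laguerrePhi α m * gammaProdMoment α 1 (P * laguerreProdPoly α m) ^ 2 := by
    conv_lhs => enter [2]; rw [mul_comm]; enter [1]; rw [h]
    rw [Finset.sum_mul, map_sum]
    refine Finset.sum_congr rfl fun m _ => ?_
    rw [smul_mul_assoc, map_smul, mul_comm (laguerreProdPoly α m), smul_eq_mul]; ring
  rw [h2]
  refine Finset.sum_pos' (fun m _ => by have := laguerrePhi_pos hα m; positivity) ?_
  by_contra hcon
  push Not at hcon
  refine hP ?_
  rw [h]
  refine Finset.sum_eq_zero fun m hm => ?_
  have hle := hcon m hm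
  have hphi := laguerrePhi_pos hα m
  have h0 : gammaProdMoment α 1 (P * laguerreProdPoly α m) = 0 := by
    by_contra hne
    have : 0 < laguerrePhi α m * gammaProdMoment α 1 (P * laguerreProdPoly α m) ^ 2 := by
      positivity
    linarith
  rw [h0, mul_zero, zero_smul]

lemma laguerreProdPoly_ne_zero {d : ℕ} {α : Fin d → ℝ} (hα : ∀ i, 0 < α i) (n : Fin d → ℕ) :
    laguerreProdPoly α n ≠ 0 := by
  intro h
  have := gammaProdMoment_laguerreProdPoly_mul hα n n
  rw [h, mul_zero, map_zero, if_pos rfl] at this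
  exact (inv_pos.2 (laguerrePhi_pos hα n)).ne this

/-- A polynomial orthogonal to all polynomials of lower degree is a combination of the product
Laguerre polynomials of its degree. -/
lemma OrthogonalBelow.eq_sum_laguerreProdPoly {d N : ℕ} {α : Fin d → ℝ} (hα : ∀ i, 0 < α i)
    {P : MvPolynomial (Fin d) ℝ} (hP : P.totalDegree ≤ N) (ho : OrthogonalBelow α N P) :
    P = ∑ m ∈ Finset.piAntidiag Finset.univ N, (laguerrePhi α m *
      gammaProdMoment α 1 (P * laguerreProdPoly α m)) • laguerreProdPoly α m := by
  conv_lhs => rw [MultiMeixner.eq_sum_laguerreProdPoly hα hP]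
  refine (Finset.sum_subset (fun m hm => ?_) fun m hm hm' => ?_).symm
  · rw [Finset.mem_piAntidiag] at hm
    exact mem_indicesLE.2 hm.1.le
  · have hlt : ∑ i, m i < N := lt_of_le_of_ne (mem_indicesLE.1 hm) fun h => hm' (by
      simp [Finset.mem_piAntidiag, h])
    rw [ho.mul_eq_zero ((totalDegree_laguerreProdPoly_le α m).trans_lt hlt), mul_zero, zero_smul]

/-! ### Negative binomial sums -/

lemma hasSum_of_eq {ι : Type*} {f g : ι → ℝ} {a b : ℝ} (h : HasSum f a) (hf : ∀ x, g x = f x)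
    (hb : b = a) : HasSum g b := by
  rw [funext hf, hb]; exact h

lemma hasSum_rising_div_factorial {c p : ℝ} (hp0 : 0 < p) (hp1 : p < 1) :
    HasSum (fun j : ℕ => rising c j / j.factorial * p ^ j) ((1 - p) ^ (-c)) := by
  have h := (Real.one_div_one_sub_rpow_hasFPowerSeriesOnBall_zero c).hasSum (y := p) (by
    rw [Metric.mem_eball, edist_zero_right, ← ofReal_norm, Real.norm_eq_abs,
      abs_of_pos hp0]
    exact ENNReal.ofReal_lt_one.2 hp1)
  rw [Real.rpow_neg (by linarith), ← one_div]
  rw [zero_add] at h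
  refine hasSum_of_eq h (fun j => ?_) rfl
  rw [FormalMultilinearSeries.ofScalars_apply_eq, smul_eq_mul, ← Ring.multichoose_eq]
  have h2 := Ring.factorial_nsmul_multichoose_eq_ascPochhammer c j
  rw [Polynomial.ascPochhammer_smeval_eq_eval, nsmul_eq_mul] at h2
  rw [rising, ← h2]
  have hf : (j.factorial : ℝ) ≠ 0 := by positivity
  field_simp

lemma nbWeight_pos {a p : ℝ} (ha : 0 < a) (hp0 : 0 < p) (hp1 : p < 1) (j : ℕ) :
    0 < nbWeight a p j := by
  have := rising_pos ha j
  have := Real.rpow_pos_of_pos (sub_pos.2 hp1) a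
  rw [nbWeight]; positivity

/-- Mixed rising and falling factorial moments of the negative binomial law. -/
lemma hasSum_nbWeight_mul (a : ℝ) {p : ℝ} (hp0 : 0 < p) (hp1 : p < 1) (k l : ℕ) :
    HasSum (fun x : ℕ => nbWeight a p x * (((1 - p) ^ k * rising (a + x) k) * x.descFactorial l))
      ((p / (1 - p)) ^ l * rising a (k + l)) := by
  have hq : 0 < 1 - p := by linarith
  -- The falling factorial vanishes for `x < l`, so the sum is shifted by `l`. Then `(a)_{x+l}
  -- (a+x+l)_k = (a)_{k+l} (a+k+l)_x` turns it into the binomial series with parameter `a + k + l`.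
  rw [← hasSum_nat_add_iff' l, Finset.sum_eq_zero, sub_zero]
  swap
  · intro i hi
    rw [Nat.descFactorial_of_lt (Finset.mem_range.1 hi)]; simp
  have h := (hasSum_rising_div_factorial (c := a + (k + l : ℕ)) hp0 hp1).mul_left
    ((1 - p) ^ a * (1 - p) ^ k * p ^ l * rising a (k + l))
  refine hasSum_of_eq h (fun x => ?_) ?_
  · have e1 : rising a (x + l) * rising (a + ((x + l : ℕ) : ℝ)) k =
        rising a (k + l) * rising (a + ((k + l : ℕ) : ℝ)) x := by
      rw [← rising_add, ← rising_add]; congr 1; omega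
    have e2 : ((x.factorial : ℝ)) * (x + l).descFactorial l = (x + l).factorial := by
      have := Nat.factorial_mul_descFactorial (Nat.le_add_left l x)
      rw [Nat.add_sub_cancel] at this
      exact_mod_cast this
    have hf : (x.factorial : ℝ) ≠ 0 := by positivity
    rw [nbWeight, ← e2]
    have hd : ((x + l).descFactorial l : ℝ) ≠ 0 := fun h0 => by
      rw [h0, mul_zero] at e2
      exact (by positivity : ((x + l).factorial : ℝ) ≠ 0) e2.symm
    field_simp
    rw [pow_add]
    linear_combination (p ^ x * p ^ l) * e1
  · rw [Real.rpow_neg hq.le, Real.rpow_add hq, Real.rpow_natCast, pow_add, div_pow]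
    have := (Real.rpow_pos_of_pos hq a).ne'
    field_simp

lemma hasSum_mul_of_nonneg {ι κ : Type*} {f : ι → ℝ} {g : κ → ℝ} {s t : ℝ} (hf0 : ∀ x, 0 ≤ f x)
    (hg0 : ∀ x, 0 ≤ g x) (hf : HasSum f s) (hg : HasSum g t) :
    HasSum (fun x : ι × κ => f x.1 * g x.2) (s * t) :=
  hf.mul hg (hf.summable.mul_of_nonneg hg.summable hf0 hg0)

lemma hasSum_pi_prod {d : ℕ} {f : Fin d → ℕ → ℝ} {s : Fin d → ℝ} (hf : ∀ i x, 0 ≤ f i x)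
    (h : ∀ i, HasSum (f i) (s i)) :
    HasSum (fun r : Fin d → ℕ => ∏ i, f i (r i)) (∏ i, s i) := by
  induction d with
  | zero =>
    simp only [Finset.univ_eq_empty, Finset.prod_empty]
    exact hasSum_unique _
  | succ d ih =>
    have h1 : HasSum (fun r : Fin d → ℕ => ∏ i, f i.succ (r i)) (∏ i : Fin d, s i.succ) :=
      ih (fun i => hf i.succ) fun i => h i.succ
    have h2 := hasSum_mul_of_nonneg (hf 0)
      (fun r => Finset.prod_nonneg fun i _ => hf i.succ (r i)) (h 0) h1
    let e : ℕ × (Fin d → ℕ) ≃ (Fin (d + 1) → ℕ) := Fin.consEquiv fun _ => ℕ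
    rw [Fin.prod_univ_succ, ← e.hasSum_iff]
    refine hasSum_of_eq h2 (fun r => ?_) rfl
    rw [Function.comp_apply, Fin.prod_univ_succ]
    simp [e, Fin.consEquiv]

/-- Given its mean `λ`, a Poisson vector has falling factorial moments `λ ^ l`; for `λ` Gamma
distributed with scale `p / (1 - p)`, the sum over `r` is then a Gamma pairing with `X ^ l`. The
proof needs only the coordinatewise moments, for monomials `P`. -/
lemma hasSum_nbProd_mul_descFactorial {d : ℕ} {α : Fin d → ℝ} (hα : ∀ i, 0 < α i) {p : ℝ}
    (hp0 : 0 < p) (hp1 : p < 1) (P : MvPolynomial (Fin d) ℝ) (l : Fin d → ℕ) :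
    HasSum (fun r : Fin d → ℕ => nbProd α p r *
        (gammaProdMoment (fun i => α i + r i) (1 - p) P * ∏ i, ((r i).descFactorial (l i) : ℝ)))
      ((p / (1 - p)) ^ (∑ i, l i) * gammaProdMoment α 1 (P * xPow l)) := by
  have hq : 0 < 1 - p := by linarith
  have hm : ∀ m : Fin d → ℕ, HasSum (fun r : Fin d → ℕ => nbProd α p r *
        (gammaProdMoment (fun i => α i + r i) (1 - p) (xPow m) *
          ∏ i, ((r i).descFactorial (l i) : ℝ)))
      ((p / (1 - p)) ^ (∑ i, l i) * gammaProdMoment α 1 (xPow m * xPow l)) := by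
    intro m
    have h := hasSum_pi_prod (fun i x => by
      have := nbWeight_pos (hα i) hp0 hp1 x
      have := rising_pos (show 0 < α i + x by have := hα i; positivity) (m i)
      positivity) fun i => hasSum_nbWeight_mul (α i) hp0 hp1 (m i) (l i)
    refine hasSum_of_eq h (fun r => ?_) ?_
    · simp only [gammaProdMoment_xPow, nbProd, Finset.prod_mul_distrib]
    · have : xPow m * xPow l = xPow (fun i => m i + l i) := by
        simp only [xPow, pow_add, Finset.prod_mul_distrib]
      rw [this, gammaProdMoment_xPow, ← Finset.prod_pow_eq_pow_sum, ← Finset.prod_mul_distrib]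
      simp
  have h := hasSum_sum fun m (_ : m ∈ P.support) => (hm (⇑m)).mul_left (P.coeff m)
  refine hasSum_of_eq h (fun r => ?_) ?_
  · conv_lhs => rw [eq_sum_smul_xPow P]
    simp only [map_sum, map_smul, smul_eq_mul, Finset.sum_mul, Finset.mul_sum]
    exact Finset.sum_congr rfl fun m _ => by ring
  · conv_lhs => rw [eq_sum_smul_xPow P]
    simp only [map_sum, map_smul, smul_mul_assoc, smul_eq_mul, Finset.sum_mul, Finset.mul_sum]
    exact Finset.sum_congr rfl fun m _ => by ring

/-- The top coefficient is recorded because it is the only one that survives against a polynomial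
orthogonal to all lower degrees. -/
lemma exists_eq_sum_descPochhammer (n : ℕ) (q : Polynomial ℝ) (hq : q.natDegree ≤ n) :
    ∃ c : ℕ → ℝ, c n = q.coeff n ∧
      q = ∑ l ∈ Finset.range (n + 1), c l • descPochhammer ℝ l := by
  induction n generalizing q with
  | zero =>
    refine ⟨fun _ => q.coeff 0, rfl, ?_⟩
    rw [Polynomial.eq_C_of_natDegree_le_zero hq]
    simp [Polynomial.smul_eq_C_mul]
  | succ n ih =>
    have hd : (q - q.coeff (n + 1) • descPochhammer ℝ (n + 1)).natDegree ≤ n := by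
      rw [Polynomial.natDegree_le_iff_coeff_eq_zero]
      intro k hk
      rw [Polynomial.coeff_sub, Polynomial.coeff_smul, smul_eq_mul]
      rcases Nat.lt_or_ge (n + 1) k with h | h
      · rw [Polynomial.coeff_eq_zero_of_natDegree_lt (hq.trans_lt h),
          Polynomial.coeff_eq_zero_of_natDegree_lt (p := descPochhammer ℝ _)
            (by rwa [descPochhammer_natDegree]), mul_zero, sub_zero]
      · obtain rfl : k = n + 1 := by omega
        have := (monic_descPochhammer ℝ (n + 1)).coeff_natDegree
        rw [descPochhammer_natDegree] at this
        rw [this, mul_one, sub_self]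
    obtain ⟨c, _, hc⟩ := ih _ hd
    refine ⟨Function.update c (n + 1) (q.coeff (n + 1)), by simp, ?_⟩
    rw [Finset.sum_range_succ, Function.update_self, ← sub_eq_iff_eq_add, hc]
    refine Finset.sum_congr rfl fun l hl => ?_
    rw [Function.update_of_ne (by have := Finset.mem_range.1 hl; omega)]

/-- Only the leading coefficients of a product of univariate polynomials matter when it is
integrated against the transform of a polynomial orthogonal to all lower degrees. -/
lemma OrthogonalBelow.hasSum_nbProd_mul_prod_eval {d N : ℕ} {α : Fin d → ℝ} (hα : ∀ i, 0 < α i)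
    {p : ℝ} (hp0 : 0 < p) (hp1 : p < 1) {P : MvPolynomial (Fin d) ℝ} (hP : OrthogonalBelow α N P)
    {q : Fin d → Polynomial ℝ} {m : Fin d → ℕ} (hq : ∀ i, (q i).natDegree ≤ m i)
    (hm : ∑ i, m i ≤ N) :
    HasSum (fun r : Fin d → ℕ => nbProd α p r *
        (gammaProdMoment (fun i => α i + r i) (1 - p) P * ∏ i, (q i).eval (r i : ℝ)))
      ((∏ i, (q i).coeff (m i)) *
        ((p / (1 - p)) ^ (∑ i, m i) * gammaProdMoment α 1 (P * xPow m))) := by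
  choose c hc hqc using fun i => exists_eq_sum_descPochhammer (m i) (q i) (hq i)
  have h := hasSum_sum fun l (_ : l ∈ Fintype.piFinset fun i => Finset.range (m i + 1)) =>
    (hasSum_nbProd_mul_descFactorial hα hp0 hp1 P l).mul_left (∏ i, c i (l i))
  refine hasSum_of_eq h (fun r => ?_) ?_
  · have he : ∀ i, (q i).eval (r i : ℝ) =
        ∑ l ∈ Finset.range (m i + 1), c i l * ((r i).descFactorial l : ℝ) := by
      intro i
      conv_lhs => rw [hqc i]
      simp [Polynomial.eval_finsetSum, descPochhammer_eval_eq_descFactorial]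
    simp only [he, Finset.prod_univ_sum, Finset.mul_sum, Finset.prod_mul_distrib]
    exact Finset.sum_congr rfl fun l _ => by ring
  · rw [Finset.sum_eq_single_of_mem m (by simp [Fintype.mem_piFinset])]
    · simp only [hc]
    · intro l hl hlm
      have hle : ∀ i, l i ≤ m i := fun i =>
        Nat.lt_succ_iff.1 (Finset.mem_range.1 (Fintype.mem_piFinset.1 hl i))
      obtain ⟨i, hi⟩ := Function.ne_iff.1 hlm
      have hlt : ∑ i, l i < ∑ i, m i := Finset.sum_lt_sum (fun i _ => hle i)
        ⟨i, Finset.mem_univ i, lt_of_le_of_ne (hle i) hi⟩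
      rw [hP l (hlt.trans_le hm), mul_zero, mul_zero]

lemma OrthogonalBelow.hasSum_nbProd_mul_eval {d N : ℕ} {α : Fin d → ℝ} (hα : ∀ i, 0 < α i)
    {p : ℝ} (hp0 : 0 < p) (hp1 : p < 1) {P Q : MvPolynomial (Fin d) ℝ}
    (hP : OrthogonalBelow α N P) (hQ : Q.totalDegree < N) :
    HasSum (fun r : Fin d → ℕ => nbProd α p r *
        (gammaProdMoment (fun i => α i + r i) (1 - p) P *
          MvPolynomial.eval (fun i => (r i : ℝ)) Q)) 0 := by
  have h := hasSum_sum fun m (hm : m ∈ Q.support) =>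
    (hP.hasSum_nbProd_mul_prod_eval hα hp0 hp1 (q := fun i => Polynomial.X ^ m i) (m := ⇑m)
      (fun i => Polynomial.natDegree_X_pow_le _)
      ((sum_le_totalDegree hm).trans hQ.le)).mul_left (Q.coeff m)
  refine hasSum_of_eq h (fun r => ?_) ?_
  · conv_lhs => rw [eq_sum_smul_xPow Q]
    simp only [map_sum, MvPolynomial.smul_eval, Finset.mul_sum, xPow, map_prod, map_pow,
      MvPolynomial.eval_X, Polynomial.eval_pow, Polynomial.eval_X]
    exact Finset.sum_congr rfl fun m _ => by ring
  · refine (Finset.sum_eq_zero fun m hm => ?_).symm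
    rw [hP _ ((sum_le_totalDegree hm).trans_lt hQ)]; ring

lemma gammaProdMoment_xPow_eq_prod_eval {d : ℕ} (α : Fin d → ℝ) (s : ℝ) (m r : Fin d → ℕ) :
    gammaProdMoment (fun i => α i + r i) s (xPow m) =
      ∏ i, (Polynomial.C (s ^ m i) * (ascPochhammer ℝ (m i)).comp
        (Polynomial.X + Polynomial.C (α i))).eval (r i : ℝ) := by
  simp only [gammaProdMoment_xPow, Polynomial.eval_mul, Polynomial.eval_C, eval_ascPochhammer_comp]

/-- The transform of Laguerre type systems into Meixner type systems is isometric in each degree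
up to powers of `p`. -/
lemma OrthogonalBelow.hasSum_nbProd_mul {d N : ℕ} {α : Fin d → ℝ} (hα : ∀ i, 0 < α i)
    {p : ℝ} (hp0 : 0 < p) (hp1 : p < 1) {P Q : MvPolynomial (Fin d) ℝ}
    (hP : OrthogonalBelow α N P) (hQ : Q.totalDegree ≤ N) :
    HasSum (fun r : Fin d → ℕ => nbProd α p r *
        (gammaProdMoment (fun i => α i + r i) (1 - p) P *
          gammaProdMoment (fun i => α i + r i) (1 - p) Q))
      (p ^ N * gammaProdMoment α 1 (P * Q)) := by
  have hq : 0 < 1 - p := by linarith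
  have h := hasSum_sum fun m (hm : m ∈ Q.support) =>
    (hP.hasSum_nbProd_mul_prod_eval hα hp0 hp1
      (q := fun i => Polynomial.C ((1 - p) ^ m i) * (ascPochhammer ℝ (m i)).comp
        (Polynomial.X + Polynomial.C (α i))) (m := ⇑m)
      (fun i => (Polynomial.natDegree_C_mul_le _ _).trans (natDegree_ascPochhammer_comp _ _).le)
      ((sum_le_totalDegree hm).trans hQ)).mul_left (Q.coeff m)
  refine hasSum_of_eq h (fun r => ?_) ?_
  · conv_lhs => rw [eq_sum_smul_xPow Q]
    simp only [map_sum, map_smul, Finset.mul_sum, gammaProdMoment_xPow_eq_prod_eval α _ _ r,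
      smul_eq_mul]
    exact Finset.sum_congr rfl fun m _ => by ring
  · conv_lhs => rw [eq_sum_smul_xPow Q]
    rw [Finset.mul_sum, map_sum, Finset.mul_sum]
    refine Finset.sum_congr rfl fun m hm => ?_
    rw [mul_smul_comm, map_smul, smul_eq_mul]
    -- Monomials of degree below `N` contribute zero on both sides. In degree `N` the leading
    -- coefficients `(1 - p) ^ m i` multiply to `(1 - p) ^ N`, which turns `(p / (1 - p)) ^ N` into
    -- `p ^ N`.
    rcases ((sum_le_totalDegree hm).trans hQ).lt_or_eq with hlt | heq
    · rw [hP _ hlt]; ring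
    · have hc : ∀ i, (Polynomial.C ((1 - p) ^ m i) * (ascPochhammer ℝ (m i)).comp
          (Polynomial.X + Polynomial.C (α i))).coeff (m i) = (1 - p) ^ m i := fun i => by
        have := (monic_ascPochhammer_comp (α i) (m i)).coeff_natDegree
        rw [natDegree_ascPochhammer_comp] at this
        rw [Polynomial.coeff_C_mul, this, mul_one]
      simp only [hc]
      rw [Finset.prod_pow_eq_pow_sum, heq, div_pow]
      field_simp

lemma exists_eval_eq_gammaProdMoment {d : ℕ} (α : Fin d → ℝ) (s : ℝ)
    (P : MvPolynomial (Fin d) ℝ) :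
    ∃ R : MvPolynomial (Fin d) ℝ, R.totalDegree ≤ P.totalDegree ∧ ∀ r : Fin d → ℕ,
      gammaProdMoment (fun i => α i + r i) s P = MvPolynomial.eval (fun i => (r i : ℝ)) R := by
  refine ⟨∑ m ∈ P.support, P.coeff m • ∏ i, Polynomial.aeval (MvPolynomial.X i)
    (Polynomial.C (s ^ m i) * (ascPochhammer ℝ (m i)).comp
      (Polynomial.X + Polynomial.C (α i))), ?_, fun r => ?_⟩
  · refine MvPolynomial.totalDegree_finsetSum_le fun m hm =>
      (MvPolynomial.totalDegree_smul_le _ _).trans ((totalDegree_prod_aeval_le fun i =>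
        (Polynomial.natDegree_C_mul_le _ _).trans (natDegree_ascPochhammer_comp _ _).le).trans
          (sum_le_totalDegree hm))
  · conv_lhs => rw [eq_sum_smul_xPow P]
    simp only [map_sum, map_smul, smul_eq_mul, MvPolynomial.smul_eval, map_prod,
      gammaProdMoment_xPow_eq_prod_eval α s _ r]
    refine Finset.sum_congr rfl fun m _ => ?_
    congr 1
    refine Finset.prod_congr rfl fun i _ => ?_
    have h := Polynomial.aeval_algHom_apply
      (MvPolynomial.aeval (R := ℝ) (fun i => (r i : ℝ))) (MvPolynomial.X i)
      (Polynomial.C (s ^ m i) * (ascPochhammer ℝ (m i)).comp (Polynomial.X + Polynomial.C (α i)))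
    rw [MvPolynomial.aeval_X, Polynomial.coe_aeval_eq_eval] at h
    rw [h, MvPolynomial.aeval_eq_eval]

/-- Systems that are orthogonal for the product Gamma weight, degree by degree, are transformed
into orthogonal systems for the product negative binomial weight. -/
lemma isOrthogonalSystem_gammaProdMoment {d : ℕ} {α : Fin d → ℝ} (hα : ∀ i, 0 < α i) {p : ℝ}
    (hp0 : 0 < p) (hp1 : p < 1) {P : (Fin d → ℕ) → MvPolynomial (Fin d) ℝ}
    (hdeg : ∀ n, (P n).totalDegree ≤ ∑ i, n i) (hbelow : ∀ n, OrthogonalBelow α (∑ i, n i) (P n))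
    (hne : ∀ n m, n ≠ m → gammaProdMoment α 1 (P n * P m) = 0) (h0 : ∀ n, P n ≠ 0) :
    IsOrthogonalSystem (nbProd α p)
      fun n r => gammaProdMoment (fun i => α i + r i) (1 - p) (P n) := by
  have hsq : ∀ n, 0 < p ^ (∑ i, n i) * gammaProdMoment α 1 (P n * P n) := fun n =>
    mul_pos (pow_pos hp0 _) (gammaProdMoment_mul_self_pos hα (h0 n))
  refine ⟨fun n => ?_, fun n m hnm => ?_, fun n => ⟨_, hsq n, ?_⟩, fun n Q hQ =>
    (hbelow n).hasSum_nbProd_mul_eval hα hp0 hp1 hQ⟩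
  · obtain ⟨R, hR, hRe⟩ := exists_eval_eq_gammaProdMoment α (1 - p) (P n)
    refine ⟨R, le_antisymm (hR.trans (hdeg n)) ?_, hRe⟩
    -- Were the degree smaller, the transform would be orthogonal to itself, against the positivity
    -- of its squared norm.
    by_contra hlt
    have h1 := (hbelow n).hasSum_nbProd_mul_eval hα hp0 hp1 (not_le.1 hlt)
    simp only [← hRe] at h1
    exact (hsq n).ne (h1.unique ((hbelow n).hasSum_nbProd_mul hα hp0 hp1 (hdeg n)))
  -- The isometry asks for orthogonality below from the factor with the larger index sum.
  · rcases le_total (∑ i, m i) (∑ i, n i) with h | h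
    · have := (hbelow n).hasSum_nbProd_mul hα hp0 hp1 ((hdeg m).trans h)
      rwa [hne n m hnm, mul_zero] at this
    · have := (hbelow m).hasSum_nbProd_mul hα hp0 hp1 ((hdeg n).trans h)
      rw [hne m n hnm.symm, mul_zero] at this
      simpa only [mul_comm (gammaProdMoment _ _ (P m))] using this
  · simpa only [sq] using (hbelow n).hasSum_nbProd_mul hα hp0 hp1 (hdeg n)

/-! ### Integrals against Gamma laws -/

lemma isProbabilityMeasure_gammaLaw {a b : ℝ} (ha : 0 < a) (hb : 0 < b) :
    IsProbabilityMeasure (gammaLaw a b) :=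
  isProbabilityMeasure_gammaMeasure ha (inv_pos.2 hb)

lemma measurable_gammaPDF (a r : ℝ) : Measurable (gammaPDF a r) :=
  (measurable_gammaPDFReal a r).ennreal_ofReal

lemma integral_gammaMeasure {a r : ℝ} (ha : 0 < a) (hr : 0 < r) (f : ℝ → ℝ) :
    ∫ x, f x ∂(gammaMeasure a r) =
      ∫ x in Set.Ioi 0, r ^ a / Real.Gamma a * x ^ (a - 1) * Real.exp (-(r * x)) * f x := by
  rw [gammaMeasure, integral_withDensity_eq_integral_toReal_smul
    (measurable_gammaPDF a r) (Filter.Eventually.of_forall fun _ => by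
      simp [gammaPDF]), ← integral_Ici_eq_integral_Ioi,
    ← setIntegral_eq_integral_of_forall_compl_eq_zero (s := Set.Ici 0)]
  · refine setIntegral_congr_fun measurableSet_Ici fun x hx => ?_
    rw [gammaPDF, ENNReal.toReal_ofReal (gammaPDFReal_nonneg ha hr x), gammaPDFReal,
      if_pos (Set.mem_Ici.1 hx), smul_eq_mul]
  · intro x hx
    rw [gammaPDF_of_neg (not_le.1 hx)]; simp

/-- Moments of Gamma laws, exponentially tilted. -/
lemma integral_gammaLaw_pow_mul_exp {a b μ : ℝ} (ha : 0 < a) (hb : 0 < b) (hμ : 0 ≤ μ) (k : ℕ) :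
    Integrable (fun z => z ^ k * Real.exp (-(μ * z))) (gammaLaw a b) ∧
      ∫ z, z ^ k * Real.exp (-(μ * z)) ∂(gammaLaw a b) =
        (b⁻¹) ^ a * ((b⁻¹ + μ)⁻¹) ^ (a + k) * rising a k := by
  have hr : 0 < b⁻¹ := inv_pos.2 hb
  have hG := Real.Gamma_pos_of_pos ha
  have hval : ∫ z, z ^ k * Real.exp (-(μ * z)) ∂(gammaLaw a b) =
        (b⁻¹) ^ a * ((b⁻¹ + μ)⁻¹) ^ (a + k) * rising a k := by
    rw [gammaLaw, integral_gammaMeasure ha hr]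
    have h1 : ∫ x in Set.Ioi (0 : ℝ), (b⁻¹) ^ a / Real.Gamma a * x ^ (a - 1) *
        Real.exp (-(b⁻¹ * x)) * (x ^ k * Real.exp (-(μ * x))) =
        ∫ x in Set.Ioi (0 : ℝ), (b⁻¹) ^ a / Real.Gamma a *
          (x ^ (a + k - 1) * Real.exp (-((b⁻¹ + μ) * x))) := by
      refine setIntegral_congr_fun measurableSet_Ioi fun x hx => ?_
      have hx' : (0 : ℝ) < x := hx
      rw [show a + (k : ℝ) - 1 = (a - 1) + k by ring, Real.rpow_add hx', Real.rpow_natCast,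
        show -((b⁻¹ + μ) * x) = -(b⁻¹ * x) + -(μ * x) by ring, Real.exp_add]
      ring
    rw [h1, integral_const_mul, Real.integral_rpow_mul_exp_neg_mul_Ioi (by positivity)
      (by positivity), gamma_add_natCast ha, one_div]
    field_simp
  -- A function that is not integrable has integral `0`, so the nonzero value just computed yields
  -- integrability.
  refine ⟨Integrable.of_integral_ne_zero ?_, hval⟩
  rw [hval]
  have := rising_pos ha k
  positivity

lemma integral_gammaLaw_pow {a b : ℝ} (ha : 0 < a) (hb : 0 < b) (c : ℝ) (k : ℕ) :
    Integrable (fun z => (z * c) ^ k) (gammaLaw a b) ∧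
      ∫ z, (z * c) ^ k ∂(gammaLaw a b) = (b * c) ^ k * rising a k := by
  obtain ⟨hi, hv⟩ := integral_gammaLaw_pow_mul_exp ha hb le_rfl k
  simp only [zero_mul, neg_zero, Real.exp_zero, mul_one, add_zero, inv_inv] at hi hv
  simp only [mul_pow, integral_mul_const]
  refine ⟨hi.mul_const _, ?_⟩
  rw [hv, Real.rpow_add hb, Real.inv_rpow hb.le, Real.rpow_natCast]
  have := (Real.rpow_pos_of_pos hb a).ne'
  field_simp

/-- Bayes' formula for the moments of the Gamma law after a Poisson observation. -/
lemma integral_gammaLaw_poisson_mul_pow {a p : ℝ} (ha : 0 < a) (hp0 : 0 < p) (hp1 : p < 1)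
    (r k : ℕ) :
    Integrable (fun z => z ^ r * Real.exp (-z) / r.factorial / nbWeight a p r *
        (z * ((1 - p) / p)) ^ k) (gammaLaw a (p / (1 - p))) ∧
      ∫ z, z ^ r * Real.exp (-z) / r.factorial / nbWeight a p r * (z * ((1 - p) / p)) ^ k
        ∂(gammaLaw a (p / (1 - p))) = (1 - p) ^ k * rising (a + r) k := by
  have hq : 0 < 1 - p := by linarith
  obtain ⟨hi, hv⟩ := integral_gammaLaw_pow_mul_exp ha (div_pos hp0 hq) zero_le_one (r + k)
  have h : ∀ z : ℝ, z ^ r * Real.exp (-z) / r.factorial / nbWeight a p r *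
      (z * ((1 - p) / p)) ^ k = ((1 - p) / p) ^ k / (r.factorial * nbWeight a p r) *
        (z ^ (r + k) * Real.exp (-(1 * z))) := by
    intro z
    rw [one_mul, mul_pow, pow_add]
    have := (nbWeight_pos ha hp0 hp1 r).ne'
    field_simp
  simp only [h]
  refine ⟨hi.const_mul _, ?_⟩
  rw [integral_const_mul, hv, nbWeight, rising_add]
  -- The prior rate `(1 - p) / p` plus `1` from the Poisson likelihood is the posterior rate `1 /
  -- p`.
  have e1 : ((p / (1 - p))⁻¹ + 1)⁻¹ = p := by field_simp; ring
  rw [e1, inv_div, Real.div_rpow hq.le hp0.le, Real.rpow_add hp0, Real.rpow_natCast, pow_add,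
    div_pow]
  have := (Real.rpow_pos_of_pos hp0 a).ne'
  have := (Real.rpow_pos_of_pos hq a).ne'
  have := (rising_pos ha r).ne'
  have hf : (r.factorial : ℝ) ≠ 0 := by positivity
  field_simp

/-- The weights `w` allow one argument for both integral representations: `w = 1` under the
posterior, and the likelihood ratio of Poisson to negative binomial under the prior. -/
lemma integral_pi_prod_mul_eval {d : ℕ} {μ : Fin d → Measure ℝ} [∀ i, SigmaFinite (μ i)]
    {w : Fin d → ℝ → ℝ} {c s : ℝ} {β : Fin d → ℝ}
    (h : ∀ i k, Integrable (fun z => w i z * (z * c) ^ k) (μ i) ∧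
      ∫ z, w i z * (z * c) ^ k ∂(μ i) = s ^ k * rising (β i) k) (P : MvPolynomial (Fin d) ℝ) :
    Integrable (fun y => (∏ i, w i (y i)) * MvPolynomial.eval (fun i => y i * c) P)
        (Measure.pi μ) ∧
      ∫ y, (∏ i, w i (y i)) * MvPolynomial.eval (fun i => y i * c) P ∂(Measure.pi μ) =
        gammaProdMoment β s P := by
  have he : ∀ y : Fin d → ℝ, (∏ i, w i (y i)) * MvPolynomial.eval (fun i => y i * c) P =
      ∑ m ∈ P.support, P.coeff m * ∏ i, (w i (y i) * (y i * c) ^ m i) := by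
    intro y
    conv_lhs => rw [eq_sum_smul_xPow P]
    simp only [map_sum, MvPolynomial.smul_eval, xPow, map_prod, map_pow, MvPolynomial.eval_X,
      Finset.mul_sum, Finset.prod_mul_distrib]
    exact Finset.sum_congr rfl fun m _ => by ring
  have hi : ∀ m : Fin d →₀ ℕ, Integrable (fun y : Fin d → ℝ =>
      P.coeff m * ∏ i, (w i (y i) * (y i * c) ^ m i)) (Measure.pi μ) := fun m =>
    (Integrable.fintype_prod (f := fun i z => w i z * (z * c) ^ m i)
      fun i => (h i (m i)).1).const_mul _
  simp only [he]
  refine ⟨integrable_finsetSum _ fun m _ => hi m, ?_⟩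
  rw [integral_finsetSum _ fun m _ => hi m]
  conv_rhs => rw [eq_sum_smul_xPow P]
  rw [map_sum]
  refine Finset.sum_congr rfl fun m _ => ?_
  rw [integral_const_mul, integral_fintype_prod_eq_prod (fun i z => w i z * (z * c) ^ m i),
    map_smul, smul_eq_mul, gammaProdMoment_xPow]
  simp only [(h _ _).2]

lemma integral_gammaProd_eval {d : ℕ} {α : Fin d → ℝ} (hα : ∀ i, 0 < α i) {b : ℝ} (hb : 0 < b)
    (c : ℝ) (P : MvPolynomial (Fin d) ℝ) :
    Integrable (fun y => MvPolynomial.eval (fun i => y i * c) P) (gammaProd α b) ∧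
      ∫ y, MvPolynomial.eval (fun i => y i * c) P ∂(gammaProd α b) =
        gammaProdMoment α (b * c) P := by
  have := fun i => isProbabilityMeasure_gammaLaw (hα i) hb
  have h := integral_pi_prod_mul_eval (μ := fun i => gammaLaw (α i) b) (w := fun _ _ => 1)
    (c := c) (s := b * c) (β := α)
    (fun i k => by simpa using integral_gammaLaw_pow (hα i) hb c k) P
  simpa [gammaProd] using h

lemma integral_gammaProd_poissonProd_mul_eval {d : ℕ} {α : Fin d → ℝ} (hα : ∀ i, 0 < α i) {p : ℝ}
    (hp0 : 0 < p) (hp1 : p < 1) (r : Fin d → ℕ) (P : MvPolynomial (Fin d) ℝ) :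
    Integrable (fun y => poissonProd y r / nbProd α p r *
        MvPolynomial.eval (fun i => y i * ((1 - p) / p)) P) (gammaProd α (p / (1 - p))) ∧
      ∫ y, poissonProd y r / nbProd α p r *
        MvPolynomial.eval (fun i => y i * ((1 - p) / p)) P ∂(gammaProd α (p / (1 - p))) =
          gammaProdMoment (fun i => α i + r i) (1 - p) P := by
  have := fun i => isProbabilityMeasure_gammaLaw (hα i) (div_pos hp0 (sub_pos.2 hp1))
  have h := integral_pi_prod_mul_eval (μ := fun i => gammaLaw (α i) (p / (1 - p)))
    (w := fun i z => z ^ r i * Real.exp (-z) / (r i).factorial / nbWeight (α i) p (r i))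
    (c := (1 - p) / p) (s := 1 - p) (β := fun i => α i + r i)
    (fun i k => integral_gammaLaw_poisson_mul_pow (hα i) hp0 hp1 (r i) k) P
  simpa only [gammaProd, poissonProd, nbProd, Finset.prod_div_distrib] using h

lemma ae_pos_gammaLaw {a b : ℝ} : ∀ᵐ z ∂(gammaLaw a b), 0 < z := by
  rw [gammaLaw, gammaMeasure, ae_withDensity_iff (measurable_gammaPDF a _)]
  -- The density is known to vanish only on negative numbers, so the null point `0` is discarded
  -- separately.
  have h0 : ∀ᵐ z : ℝ, z ≠ 0 := by simp [ae_iff]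
  filter_upwards [h0] with z hz hne
  by_contra hle
  exact hne (gammaPDF_of_neg (lt_of_le_of_ne (not_lt.1 hle) hz))

lemma ae_pos_gammaProd {d : ℕ} {α : Fin d → ℝ} (hα : ∀ i, 0 < α i) {b : ℝ} (hb : 0 < b) :
    ∀ᵐ y ∂(gammaProd α b), ∀ i, 0 < y i := by
  have := fun i => isProbabilityMeasure_gammaLaw (hα i) hb
  exact Filter.eventually_all.2 fun i =>
    (Measure.tendsto_eval_ae_ae (μ := fun i => gammaLaw (α i) b) (i := i)).eventually
      ae_pos_gammaLaw

lemma integral_gammaLaw_eval {a b : ℝ} (ha : 0 < a) (hb : 0 < b) (c : ℝ) (q : Polynomial ℝ) :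
    ∫ z, q.eval (z * c) ∂(gammaLaw a b) = gammaMoment a (b * c) q := by
  have h : ∀ z, q.eval (z * c) =
      ∑ k ∈ Finset.range (q.natDegree + 1), q.coeff k * (z * c) ^ k := fun z => by
    rw [Polynomial.eval_eq_sum_range]
  simp only [h]
  rw [integral_finsetSum _ fun k _ => (integral_gammaLaw_pow ha hb c k).1.const_mul _]
  conv_rhs => rw [q.as_sum_range]
  rw [map_sum]
  refine Finset.sum_congr rfl fun k _ => ?_
  rw [integral_const_mul, (integral_gammaLaw_pow ha hb c k).2, gammaMoment_monomial]

lemma meixner_eq_gammaMoment {a p x : ℝ} (hx : 0 < a + x) (hp0 : 0 < p) (n : ℕ) :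
    meixner a p n x = gammaMoment (a + x) (1 - p) (laguerrePoly a n) := by
  simp only [meixner, ← eval_laguerrePoly]
  rw [integral_gammaLaw_eval hx hp0, mul_div_cancel₀ _ hp0.ne']

lemma eval_prod_aeval {d : ℕ} (q : Fin d → Polynomial ℝ) (y : Fin d → ℝ) :
    MvPolynomial.eval y (∏ i, Polynomial.aeval (MvPolynomial.X i) (q i)) =
      ∏ i, (q i).eval (y i) := by
  rw [map_prod]
  refine Finset.prod_congr rfl fun i _ => ?_
  have h := Polynomial.aeval_algHom_apply (MvPolynomial.aeval (R := ℝ) y) (MvPolynomial.X i) (q i)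
  rw [MvPolynomial.aeval_X, Polynomial.coe_aeval_eq_eval] at h
  rw [h, MvPolynomial.aeval_eq_eval]

lemma eval_laguerreProdPoly {d : ℕ} (α : Fin d → ℝ) (n : Fin d → ℕ) (y : Fin d → ℝ) :
    MvPolynomial.eval y (laguerreProdPoly α n) = laguerreProd α n y := by
  rw [laguerreProdPoly, eval_prod_aeval]
  simp only [eval_laguerrePoly, laguerreProd]

lemma meixnerProd_eq_gammaProdMoment {d : ℕ} {α : Fin d → ℝ} (hα : ∀ i, 0 < α i) {p : ℝ}
    (hp0 : 0 < p) (n r : Fin d → ℕ) :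
    meixnerProd α p n r =
      gammaProdMoment (fun i => α i + r i) (1 - p) (laguerreProdPoly α n) := by
  rw [laguerreProdPoly, gammaProdMoment_prod_aeval, meixnerProd]
  refine Finset.prod_congr rfl fun i _ => meixner_eq_gammaMoment ?_ hp0 _
  have := hα i; positivity

/-! ### Jacobi polynomials on the simplex -/

lemma jacobi_div_mul_pow (a b : ℝ) (n : ℕ) {u v : ℝ} (h : u + v = 0 → u = 0) :
    jacobi a b n (u / (u + v)) * (u + v) ^ n = jacobiHom a b n u v := by
  rw [jacobi, jacobiHom, Finset.sum_mul]
  refine Finset.sum_congr rfl fun k hk => ?_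
  obtain ⟨j, rfl⟩ := Nat.exists_eq_add_of_le (Nat.lt_succ_iff.1 (Finset.mem_range.1 hk))
  rw [smul_eq_mul, mul_assoc, Nat.add_sub_cancel_left]
  congr 1
  -- If `u + v = 0`, the quotient is `0` by convention, and the hypothesis forces `u = v = 0`. Each
  -- term is then `0 ^ (k + j)` up to its coefficient, on both sides.
  by_cases hw : u + v = 0
  · have hu := h hw
    have hv : v = 0 := by linarith
    subst hu hv
    rcases Nat.eq_zero_or_pos k with rfl | hk
    · simp
    · simp [hk.ne']
  · rw [pow_add, ← mul_assoc, ← mul_pow]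
    congr 2
    field_simp
    ring

lemma sum_Iio_add_sum_Ioi {d : ℕ} (t : Fin d → ℝ) (j : Fin d) :
    (∑ i ∈ Finset.Iio j, t i) + (t j + ∑ i ∈ Finset.Ioi j, t i) = ∑ i, t i := by
  have h1 : t j + ∑ i ∈ Finset.Ioi j, t i = ∑ i ∈ Finset.Ici j, t i := by
    rw [← Finset.Ioi_insert, Finset.sum_insert (by simp)]
  rw [h1, ← Finset.sum_union]
  · congr 1
    ext i
    simp [lt_or_ge]
  · rw [Finset.disjoint_left]
    intro i hi hi'
    rw [Finset.mem_Iio] at hi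
    rw [Finset.mem_Ici] at hi'
    exact absurd hi (not_lt.2 hi')

/-- On the simplex `1 - s_{j-1}` is the tail sum `x_j + x_{j+1} + ⋯`, so each factor is a
homogenized Jacobi polynomial. Nonnegativity handles the faces where the tail vanishes. -/
lemma jacobiSimplex_eq_eval {k : ℕ} (α : Fin (k + 1) → ℝ) (l : Fin k → ℕ) {t : Fin (k + 1) → ℝ}
    (ht : ∀ i, 0 ≤ t i) (hs : ∑ i, t i = 1) :
    jacobiSimplex α l t = MvPolynomial.eval t (jacobiSimplexPoly α l) := by
  rw [jacobiSimplexPoly, map_prod, jacobiSimplex]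
  refine Finset.prod_congr rfl fun j _ => ?_
  rw [← MvPolynomial.coe_aeval_eq_eval, RingHom.coe_coe, map_jacobiHom, map_sum]
  simp only [MvPolynomial.aeval_X]
  have hw : 1 - ∑ i ∈ Finset.Iio j.castSucc, t i =
      t j.castSucc + ∑ i ∈ Finset.Ioi j.castSucc, t i := by
    rw [← hs, ← sum_Iio_add_sum_Ioi t j.castSucc]; ring
  rw [hw, jacobi_div_mul_pow]
  intro h0
  have := ht j.castSucc
  have : 0 ≤ ∑ i ∈ Finset.Ioi j.castSucc, t i := Finset.sum_nonneg fun i _ => ht i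
  linarith

lemma eval_mul_of_isHomogeneous {d M : ℕ} {F : MvPolynomial (Fin d) ℝ} (hF : F.IsHomogeneous M)
    (c : ℝ) (y : Fin d → ℝ) :
    MvPolynomial.eval (fun i => y i * c) F = c ^ M * MvPolynomial.eval y F := by
  refine linearMap_eq_of_isHomogeneous
    (L₁ := (MvPolynomial.aeval (R := ℝ) fun i => y i * c).toLinearMap)
    (L₂ := c ^ M • (MvPolynomial.aeval (R := ℝ) y).toLinearMap) (fun m hm => ?_) hF
  simp only [AlgHom.toLinearMap_apply, LinearMap.smul_apply, xPow, map_prod, map_pow,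
    MvPolynomial.aeval_X, mul_pow, Finset.prod_mul_distrib, Finset.prod_pow_eq_pow_sum, hm,
    smul_eq_mul, mul_comm]

lemma eval_laguerreStarPoly {k : ℕ} (α : Fin (k + 1) → ℝ) (n : Fin (k + 1) → ℕ)
    {y : Fin (k + 1) → ℝ} (hy : ∀ i, 0 < y i) :
    MvPolynomial.eval y (laguerreStarPoly α n) = laguerreStar α n y := by
  have hs : 0 < ∑ i, y i := sum_pos_of_pos hy
  rw [laguerreStar, jacobiSimplex_eq_eval _ _ (fun i => (div_pos (hy i) hs).le)
    (by rw [← Finset.sum_div, div_self hs.ne'])]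
  simp only [div_eq_mul_inv]
  rw [eval_mul_of_isHomogeneous (isHomogeneous_jacobiSimplexPoly _ _), laguerreStarPoly, map_mul]
  have h := Polynomial.aeval_algHom_apply (MvPolynomial.aeval (R := ℝ) y) (xSum (k + 1))
    (laguerrePoly ((∑ i, α i) + 2 * ((∑ i : Fin k, n i.castSucc : ℕ) : ℝ)) (n (Fin.last k)))
  simp only [xSum, map_sum, MvPolynomial.aeval_X] at h
  rw [Polynomial.coe_aeval_eq_eval, MvPolynomial.aeval_eq_eval, eval_laguerrePoly] at h
  rw [xSum, ← h, mul_assoc, ← mul_assoc (_ ^ _) (_ ^ _), ← mul_pow, mul_inv_cancel₀ hs.ne', one_pow,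
    one_mul]

/-! ### Moments of the Dirichlet law -/

lemma lintegral_Ioo_rpow_mul_rpow {s t c : ℝ} (hs : 0 < s) (ht : 0 < t) (hc : 0 < c) :
    ∫⁻ x in Set.Ioo 0 c, ENNReal.ofReal (x ^ (s - 1) * (c - x) ^ (t - 1)) =
      ENNReal.ofReal (c ^ (s + t - 1) * (Real.Gamma s * Real.Gamma t / Real.Gamma (s + t))) := by
  have him : (fun u : ℝ => c * u) '' Set.Ioo 0 1 = Set.Ioo 0 c := by
    ext x
    constructor
    · rintro ⟨u, ⟨h0, h1⟩, rfl⟩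
      exact ⟨mul_pos hc h0, by nlinarith⟩
    · rintro ⟨h0, h1⟩
      exact ⟨x / c, ⟨div_pos h0 hc, (div_lt_one hc).2 h1⟩, mul_div_cancel₀ x hc.ne'⟩
  have hb := lintegral_betaPDF_eq_one hs ht
  rw [lintegral_betaPDF] at hb
  rw [← him, lintegral_image_eq_lintegral_abs_deriv_mul (f := fun u => c * u)
    (f' := fun _ => c * 1) measurableSet_Ioo
    (fun u _ => ((hasDerivAt_id' u).const_mul c).hasDerivWithinAt)
    (fun u _ v _ h => mul_left_cancel₀ hc.ne' h)]
  have hB := beta_pos hs ht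
  have hpt : ∀ u ∈ Set.Ioo (0 : ℝ) 1, ENNReal.ofReal |c * 1| *
      ENNReal.ofReal ((c * u) ^ (s - 1) * (c - c * u) ^ (t - 1)) =
      ENNReal.ofReal (c ^ (s + t - 1) * beta s t) *
        ENNReal.ofReal (1 / beta s t * u ^ (s - 1) * (1 - u) ^ (t - 1)) := by
    rintro u ⟨h0, h1⟩
    rw [← ENNReal.ofReal_mul (abs_nonneg _), ← ENNReal.ofReal_mul (by positivity)]
    congr 1
    rw [show c - c * u = c * (1 - u) by ring, Real.mul_rpow hc.le h0.le,
      Real.mul_rpow hc.le (by linarith), mul_one, abs_of_pos hc,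
      show s + t - 1 = 1 + (s - 1) + (t - 1) by ring, Real.rpow_add hc, Real.rpow_add hc,
      Real.rpow_one]
    field_simp
  rw [setLIntegral_congr_fun measurableSet_Ioo hpt, lintegral_const_mul' _ _ ENNReal.ofReal_ne_top,
    hb, mul_one, beta]

/-- The unnormalized density `∏ x_i ^ (a_i - 1 + m_i) * (c - ∑ x_i) ^ (b - 1 + q)` on the simplex
of side `c`, with the integer powers kept separate. -/
def simplexDensity {k : ℕ} (a : Fin k → ℝ) (m : Fin k → ℕ) (b : ℝ) (q : ℕ) (c : ℝ)
    (x : Fin k → ℝ) : ENNReal :=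
  Set.indicator {x : Fin k → ℝ | (∀ i, 0 ≤ x i) ∧ ∑ i, x i ≤ c}
    (fun x => ENNReal.ofReal ((∏ i, (x i ^ (a i - 1) * x i ^ m i)) *
      ((c - ∑ i, x i) ^ (b - 1) * (c - ∑ i, x i) ^ q))) x

lemma measurableSet_simplex {k : ℕ} (c : ℝ) :
    MeasurableSet {x : Fin k → ℝ | (∀ i, 0 ≤ x i) ∧ ∑ i, x i ≤ c} := by
  have h : {x : Fin k → ℝ | (∀ i, 0 ≤ x i) ∧ ∑ i, x i ≤ c} =
      (⋂ i, {x : Fin k → ℝ | 0 ≤ x i}) ∩ {x | ∑ i, x i ≤ c} := by ext; simp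
  rw [h]
  exact (MeasurableSet.iInter fun i => measurableSet_le measurable_const (measurable_pi_apply i)).inter
    (measurableSet_le (by fun_prop) measurable_const)

lemma measurable_simplexDensity {k : ℕ} (a : Fin k → ℝ) (m : Fin k → ℕ) (b : ℝ) (q : ℕ) (c : ℝ) :
    Measurable (simplexDensity a m b q c) := by
  refine Measurable.indicator ?_ (measurableSet_simplex c)
  fun_prop

lemma simplexDensity_eq_zero {k : ℕ} (a : Fin k → ℝ) (m : Fin k → ℕ) (b : ℝ) (q : ℕ) {c : ℝ}
    (hc : c < 0) (x : Fin k → ℝ) : simplexDensity a m b q c x = 0 := by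
  refine Set.indicator_of_notMem (fun h => ?_) _
  have := Finset.sum_nonneg fun i (_ : i ∈ Finset.univ) => h.1 i
  linarith [h.2]

lemma simplexDensity_cons {k : ℕ} (a : Fin (k + 1) → ℝ) (m : Fin (k + 1) → ℕ) (b : ℝ) (q : ℕ)
    (c z : ℝ) (hz : 0 ≤ z) (x : Fin k → ℝ) :
    simplexDensity a m b q c (Fin.cons z x) = ENNReal.ofReal (z ^ (a 0 - 1) * z ^ m 0) *
      simplexDensity (fun i => a i.succ) (fun i => m i.succ) b q (c - z) x := by
  have hmem : (Fin.cons z x : Fin (k + 1) → ℝ) ∈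
      {x : Fin (k + 1) → ℝ | (∀ i, 0 ≤ x i) ∧ ∑ i, x i ≤ c} ↔
      x ∈ {x : Fin k → ℝ | (∀ i, 0 ≤ x i) ∧ ∑ i, x i ≤ c - z} := by
    simp only [Set.mem_ofPred_eq, Fin.forall_fin_succ, Fin.cons_zero, Fin.cons_succ,
      Fin.sum_univ_succ, hz, true_and, le_sub_iff_add_le']
  by_cases h : x ∈ {x : Fin k → ℝ | (∀ i, 0 ≤ x i) ∧ ∑ i, x i ≤ c - z}
  · rw [simplexDensity, simplexDensity, Set.indicator_of_mem h, Set.indicator_of_mem (hmem.2 h),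
      ← ENNReal.ofReal_mul (by positivity)]
    simp only [Fin.prod_univ_succ, Fin.sum_univ_succ, Fin.cons_zero, Fin.cons_succ]
    rw [mul_assoc, sub_sub]
  · rw [simplexDensity, simplexDensity, Set.indicator_of_notMem h,
      Set.indicator_of_notMem (mt hmem.1 h), mul_zero]

lemma simplexDensity_cons_of_neg {k : ℕ} (a : Fin (k + 1) → ℝ) (m : Fin (k + 1) → ℕ) (b : ℝ)
    (q : ℕ) (c z : ℝ) (hz : z < 0) (x : Fin k → ℝ) :
    simplexDensity a m b q c (Fin.cons z x) = 0 := by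
  refine Set.indicator_of_notMem (fun h => ?_) _
  have := h.1 0
  rw [Fin.cons_zero] at this
  linarith

lemma lintegral_fin_succ {k : ℕ} {f : (Fin (k + 1) → ℝ) → ENNReal} (hf : Measurable f) :
    ∫⁻ x, f x = ∫⁻ z : ℝ, ∫⁻ x : Fin k → ℝ, f (Fin.cons z x) := by
  have hmp := (volume_preserving_piFinSuccAbove (fun _ : Fin (k + 1) => ℝ) 0).symm
  rw [← hmp.lintegral_comp hf, Measure.volume_eq_prod, lintegral_prod]
  · simp [MeasurableEquiv.piFinSuccAbove, Fin.insertNthEquiv]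
  · exact (hf.comp hmp.measurable).aemeasurable

/-- Dirichlet's integral: by Tonelli, fixing the first coordinate `z` leaves the same integral on
the simplex of side `c - z`, and a Beta integral in `z` remains. -/
lemma lintegral_simplexDensity {k : ℕ} {a : Fin k → ℝ} (ha : ∀ i, 0 < a i) (m : Fin k → ℕ)
    {b : ℝ} (hb : 0 < b) (q : ℕ) {c : ℝ} (hc : 0 < c) :
    ∫⁻ x, simplexDensity a m b q c x =
      ENNReal.ofReal (c ^ ((∑ i, (a i + m i)) + (b + q) - 1) *
        ((∏ i, Real.Gamma (a i + m i)) * Real.Gamma (b + q) /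
          Real.Gamma ((∑ i, (a i + m i)) + (b + q)))) := by
  induction k generalizing c with
  | zero =>
    have hG : Real.Gamma (b + q) ≠ 0 := (Real.Gamma_pos_of_pos (by positivity)).ne'
    rw [volume_pi, Measure.pi_of_empty, lintegral_dirac, simplexDensity, Set.indicator_of_mem (by
      simp [hc.le])]
    simp only [Finset.univ_eq_empty, Finset.prod_empty, Finset.sum_empty, sub_zero, zero_add,
      one_mul, div_self hG, mul_one]
    rw [show b + (q : ℝ) - 1 = (b - 1) + q by ring, Real.rpow_add hc, Real.rpow_natCast]
  | succ k ih =>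
    set B : ℝ := (∑ i : Fin k, (a i.succ + m i.succ)) + (b + q) with hB
    have hB0 : 0 < B := by
      have : 0 ≤ ∑ i : Fin k, (a i.succ + (m i.succ : ℝ)) :=
        Finset.sum_nonneg fun i _ => by have := ha i.succ; positivity
      positivity
    set C : ℝ := (∏ i : Fin k, Real.Gamma (a i.succ + m i.succ)) * Real.Gamma (b + q) /
      Real.Gamma B with hC
    have hA : 0 < a 0 + m 0 := by have := ha 0; positivity
    have hGB := Real.Gamma_pos_of_pos hB0
    have hGA := Real.Gamma_pos_of_pos (add_pos hA hB0)
    rw [lintegral_fin_succ (measurable_simplexDensity a m b q c)]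
    -- The values `z = 0` and `z = c` are discarded: the power rules need positive bases, and the
    -- induction hypothesis needs `c - z > 0`.
    have hae : ∀ᵐ z : ℝ, ∫⁻ x : Fin k → ℝ, simplexDensity a m b q c (Fin.cons z x) =
        Set.indicator (Set.Ioo 0 c) (fun z => ENNReal.ofReal
          (z ^ (a 0 + m 0 - 1) * (c - z) ^ (B - 1)) * ENNReal.ofReal C) z := by
      have h0 : ∀ᵐ z : ℝ, z ≠ 0 := by simp [ae_iff]
      have h1 : ∀ᵐ z : ℝ, z ≠ c := by simp [ae_iff]
      filter_upwards [h0, h1] with z hz0 hzc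
      rcases lt_or_gt_of_ne hz0 with hz | hz
      · rw [Set.indicator_of_notMem fun h : z ∈ Set.Ioo 0 c => absurd h.1 (not_lt.2 hz.le)]
        simp [simplexDensity_cons_of_neg _ _ _ _ _ _ hz]
      · simp only [simplexDensity_cons _ _ _ _ _ _ hz.le]
        rw [lintegral_const_mul' _ _ ENNReal.ofReal_ne_top]
        rcases lt_or_gt_of_ne hzc with hlt | hgt
        · have hcz := sub_pos.2 hlt
          rw [Set.indicator_of_mem (show z ∈ Set.Ioo 0 c from ⟨hz, hlt⟩),
            ih (fun i => ha i.succ) (fun i => m i.succ) hcz, ← hB, ← hC,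
            ← ENNReal.ofReal_mul (by positivity), ← ENNReal.ofReal_mul
              (mul_nonneg (Real.rpow_nonneg hz.le _) (Real.rpow_nonneg hcz.le _)),
            show a 0 + (m 0 : ℝ) - 1 = (a 0 - 1) + m 0 by ring, Real.rpow_add hz,
            Real.rpow_natCast, mul_assoc _ _ C]
        · rw [Set.indicator_of_notMem fun h : z ∈ Set.Ioo 0 c => absurd h.2 (not_lt.2 hgt.le)]
          simp [simplexDensity_eq_zero _ _ _ _ (sub_neg.2 hgt)]
    rw [lintegral_congr_ae hae, lintegral_indicator measurableSet_Ioo,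
      lintegral_mul_const' _ _ ENNReal.ofReal_ne_top, lintegral_Ioo_rpow_mul_rpow hA hB0 hc,
      ← ENNReal.ofReal_mul (by
        have := Real.Gamma_pos_of_pos hA
        positivity)]
    congr 1
    rw [Fin.sum_univ_succ, Fin.prod_univ_succ, add_assoc (a 0 + (m 0 : ℝ)), ← hB, hC]
    field_simp

lemma measurable_dirichletMap {k : ℕ} :
    Measurable fun x : Fin k → ℝ => (Fin.snoc x (1 - ∑ i, x i) : Fin (k + 1) → ℝ) := by
  refine measurable_pi_lambda _ fun i => ?_
  induction i using Fin.lastCases with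
  | last => simp only [Fin.snoc_last]; fun_prop
  | cast i => simp only [Fin.snoc_castSucc]; fun_prop

lemma measurable_dirichletDensity {k : ℕ} (β : Fin (k + 1) → ℝ) :
    Measurable (Set.indicator {x : Fin k → ℝ | (∀ i, 0 ≤ x i) ∧ ∑ i, x i ≤ 1}
      fun x => ENNReal.ofReal (dirichletDensity β x)) := by
  refine Measurable.indicator ?_ (measurableSet_simplex 1)
  unfold dirichletDensity
  fun_prop

lemma ae_dirichlet {k : ℕ} (β : Fin (k + 1) → ℝ) :
    ∀ᵐ t ∂(dirichlet β), (∀ i, 0 ≤ t i) ∧ ∑ i, t i = 1 := by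
  have hms : MeasurableSet {t : Fin (k + 1) → ℝ | (∀ i, 0 ≤ t i) ∧ ∑ i, t i = 1} := by
    have h : {t : Fin (k + 1) → ℝ | (∀ i, 0 ≤ t i) ∧ ∑ i, t i = 1} =
        (⋂ i, {x : Fin (k + 1) → ℝ | 0 ≤ x i}) ∩ {x | ∑ i, x i = 1} := by ext; simp
    rw [h]
    exact (MeasurableSet.iInter fun i => measurableSet_le measurable_const
      (measurable_pi_apply i)).inter (measurableSet_eq_fun (by fun_prop) measurable_const)
  rw [dirichlet, ae_map_iff measurable_dirichletMap.aemeasurable hms,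
    ae_withDensity_iff (measurable_dirichletDensity β)]
  refine Filter.Eventually.of_forall fun x hx => ?_
  have hmem := Set.mem_of_indicator_ne_zero hx
  refine ⟨fun i => ?_, by simp [Fin.sum_univ_castSucc]⟩
  induction i using Fin.lastCases with
  | last => rw [Fin.snoc_last]; linarith [hmem.2]
  | cast i => rw [Fin.snoc_castSucc]; exact hmem.1 i

lemma eval_xPow {d : ℕ} (m : Fin d → ℕ) (t : Fin d → ℝ) :
    MvPolynomial.eval t (xPow m) = ∏ i, t i ^ m i := by
  simp [xPow]

/-- A monomial times the density is again of Dirichlet type, so the moment is a quotient of Gamma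
functions. The lower integral gives integrability and value together. -/
lemma integral_dirichlet_xPow {k : ℕ} {β : Fin (k + 1) → ℝ} (hβ : ∀ i, 0 < β i)
    (m : Fin (k + 1) → ℕ) :
    Integrable (fun t => MvPolynomial.eval t (xPow m)) (dirichlet β) ∧
      ∫ t, MvPolynomial.eval t (xPow m) ∂(dirichlet β) =
        gammaProdMoment β 1 (xPow m) / rising (∑ i, β i) (∑ i, m i) := by
  have hS := sum_pos_of_pos hβ
  have hGS := Real.Gamma_pos_of_pos hS
  have hGP : 0 < ∏ i, Real.Gamma (β i) := Finset.prod_pos fun i _ => Real.Gamma_pos_of_pos (hβ i)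
  have hmeas : Measurable fun t : Fin (k + 1) → ℝ => MvPolynomial.eval t (xPow m) := by
    simp only [eval_xPow]; fun_prop
  have hnn : 0 ≤ᵐ[dirichlet β] fun t => MvPolynomial.eval t (xPow m) := by
    filter_upwards [ae_dirichlet β] with t ht
    rw [eval_xPow]
    exact Finset.prod_nonneg fun i _ => pow_nonneg (ht.1 i) _
  have hpos : 0 < gammaProdMoment β 1 (xPow m) / rising (∑ i, β i) (∑ i, m i) := by
    rw [gammaProdMoment_xPow]
    refine div_pos (Finset.prod_pos fun i _ => ?_) (rising_pos hS _)
    have := rising_pos (hβ i) (m i)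
    positivity
  have hval : ∫⁻ t, ENNReal.ofReal (MvPolynomial.eval t (xPow m)) ∂(dirichlet β) =
      ENNReal.ofReal (gammaProdMoment β 1 (xPow m) / rising (∑ i, β i) (∑ i, m i)) := by
    rw [dirichlet, lintegral_map hmeas.ennreal_ofReal measurable_dirichletMap]
    refine (lintegral_withDensity_eq_lintegral_mul _ (measurable_dirichletDensity β)
        (hmeas.ennreal_ofReal.comp measurable_dirichletMap)).trans ?_
    have hpt : ∀ x : Fin k → ℝ, (Set.indicator {x : Fin k → ℝ | (∀ i, 0 ≤ x i) ∧ ∑ i, x i ≤ 1}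
        (fun x => ENNReal.ofReal (dirichletDensity β x)) * fun x => ENNReal.ofReal
          (MvPolynomial.eval (Fin.snoc x (1 - ∑ i, x i) : Fin (k + 1) → ℝ) (xPow m))) x =
        ENNReal.ofReal (Real.Gamma (∑ i, β i) / ∏ i, Real.Gamma (β i)) *
          simplexDensity (fun i => β i.castSucc) (fun i => m i.castSucc) (β (Fin.last k))
            (m (Fin.last k)) 1 x := by
      intro x
      rw [Pi.mul_apply]
      by_cases h : x ∈ {x : Fin k → ℝ | (∀ i, 0 ≤ x i) ∧ ∑ i, x i ≤ 1}
      · have h1 : 0 ≤ 1 - ∑ i, x i := by linarith [h.2]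
        have h2 : 0 ≤ ∏ i, x i ^ (β i.castSucc - 1) :=
          Finset.prod_nonneg fun i _ => Real.rpow_nonneg (h.1 i) _
        have h3 : 0 ≤ dirichletDensity β x := by unfold dirichletDensity; positivity
        rw [simplexDensity, Set.indicator_of_mem h, Set.indicator_of_mem h,
          ← ENNReal.ofReal_mul h3, ← ENNReal.ofReal_mul (div_pos hGS hGP).le, eval_xPow]
        congr 1
        simp only [Fin.prod_univ_castSucc, Fin.snoc_castSucc, Fin.snoc_last, dirichletDensity,
          Finset.prod_mul_distrib]
        ring
      · rw [simplexDensity, Set.indicator_of_notMem h, Set.indicator_of_notMem h, zero_mul,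
          mul_zero]
    refine (lintegral_congr hpt).trans ?_
    rw [lintegral_const_mul' _ _ ENNReal.ofReal_ne_top,
      lintegral_simplexDensity (fun i => hβ i.castSucc) _ (hβ _) _ one_pos,
      ← ENNReal.ofReal_mul (by positivity), Real.one_rpow, one_mul,
      ← Fin.sum_univ_castSucc fun i => β i + (m i : ℝ),
      ← Fin.prod_univ_castSucc fun i => Real.Gamma (β i + (m i : ℝ))]
    congr 1
    rw [Finset.sum_add_distrib, ← Nat.cast_sum, gamma_add_natCast hS,
      Finset.prod_congr rfl fun i _ => gamma_add_natCast (hβ i) (m i), Finset.prod_mul_distrib,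
      gammaProdMoment_xPow]
    have := (rising_pos hS (∑ i, m i)).ne'
    simp only [one_pow, one_mul]
    field_simp
  refine ⟨⟨hmeas.aestronglyMeasurable, ?_⟩, ?_⟩
  · rw [hasFiniteIntegral_iff_ofReal hnn, hval]
    exact ENNReal.ofReal_lt_top
  · rw [integral_eq_lintegral_of_nonneg_ae hnn hmeas.aestronglyMeasurable, hval,
      ENNReal.toReal_ofReal hpos.le]

lemma integral_dirichlet_eval {k M : ℕ} {β : Fin (k + 1) → ℝ} (hβ : ∀ i, 0 < β i)
    {F : MvPolynomial (Fin (k + 1)) ℝ} (hF : F.IsHomogeneous M) :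
    Integrable (fun t => MvPolynomial.eval t F) (dirichlet β) ∧
      ∫ t, MvPolynomial.eval t F ∂(dirichlet β) =
        gammaProdMoment β 1 F / rising (∑ i, β i) M := by
  have he : ∀ t : Fin (k + 1) → ℝ, MvPolynomial.eval t F =
      ∑ m ∈ F.support, F.coeff m * MvPolynomial.eval t (xPow m) := by
    intro t
    conv_lhs => rw [eq_sum_smul_xPow F]
    simp only [map_sum, MvPolynomial.smul_eval]
  simp only [he]
  refine ⟨integrable_finsetSum _ fun (m : Fin (k + 1) →₀ ℕ) _ =>
    (integral_dirichlet_xPow hβ (⇑m)).1.const_mul (F.coeff m), ?_⟩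
  rw [integral_finsetSum _ fun (m : Fin (k + 1) →₀ ℕ) _ =>
    (integral_dirichlet_xPow hβ (⇑m)).1.const_mul (F.coeff m)]
  conv_rhs => rw [eq_sum_smul_xPow F]
  rw [map_sum, Finset.sum_div]
  refine Finset.sum_congr rfl fun m hm => ?_
  rw [integral_const_mul, (integral_dirichlet_xPow hβ m).2, map_smul, smul_eq_mul,
    sum_eq_of_isHomogeneous hF hm, mul_div_assoc]

lemma integral_dirichlet_jacobiSimplex_mul {k M : ℕ} {β : Fin (k + 1) → ℝ} (hβ : ∀ i, 0 < β i)
    (α : Fin (k + 1) → ℝ) (l : Fin k → ℕ) {F : MvPolynomial (Fin (k + 1)) ℝ}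
    (hF : F.IsHomogeneous M) :
    Integrable (fun t => jacobiSimplex α l t * MvPolynomial.eval t F) (dirichlet β) ∧
      ∫ t, jacobiSimplex α l t * MvPolynomial.eval t F ∂(dirichlet β) =
        gammaProdMoment β 1 (jacobiSimplexPoly α l * F) / rising (∑ i, β i) ((∑ i, l i) + M) := by
  have hae : (fun t => MvPolynomial.eval t (jacobiSimplexPoly α l * F)) =ᵐ[dirichlet β]
      fun t => jacobiSimplex α l t * MvPolynomial.eval t F := by
    filter_upwards [ae_dirichlet β] with t ht
    rw [map_mul, jacobiSimplex_eq_eval α l ht.1 ht.2]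
  have h := integral_dirichlet_eval hβ ((isHomogeneous_jacobiSimplexPoly α l).mul hF)
  exact ⟨h.1.congr hae, (integral_congr_ae hae).symm.trans h.2⟩

lemma hahn_eq {k : ℕ} {α : Fin (k + 1) → ℝ} (hα : ∀ i, 0 < α i) (l : Fin k → ℕ)
    (r : Fin (k + 1) → ℕ) :
    hahn α l r = gammaProdMoment (fun i => α i + r i) 1 (jacobiSimplexPoly α l) /
      rising (∑ i, (α i + r i)) (∑ i, l i) := by
  have h := (integral_dirichlet_jacobiSimplex_mul (β := fun i => α i + r i)
    (fun i => by have := hα i; positivity) α l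
    (MvPolynomial.isHomogeneous_one (Fin (k + 1)) ℝ)).2
  simpa [hahn] using h

/-- Explains the form of `meixnerStar`. The shift of `|r|` by `N` produces the shape `|α| + |r| + N`
left by a homogeneous factor of degree `N`, the factor `(1 - p) ^ N` comes from scaling, and the
rising factorial cancels the Dirichlet normalization inside `hahn`. -/
lemma meixnerStar_eq_gammaProdMoment {k : ℕ} {α : Fin (k + 1) → ℝ} (hα : ∀ i, 0 < α i) {p : ℝ}
    (hp0 : 0 < p) (n r : Fin (k + 1) → ℕ) :
    meixnerStar α p n r =
      gammaProdMoment (fun i => α i + r i) (1 - p) (laguerreStarPoly α n) := by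
  set N := ∑ i : Fin k, n i.castSucc with hN
  have hpos : 0 < ∑ i, (α i + (r i : ℝ)) :=
    sum_pos_of_pos fun i => by have := hα i; positivity
  have hx : (∑ i, α i) + 2 * (N : ℝ) + (((∑ i, r i : ℕ) : ℝ) - (N : ℝ)) =
      (∑ i, (α i + (r i : ℝ))) + N := by
    rw [Finset.sum_add_distrib]; push_cast; ring
  rw [meixnerStar, laguerreStarPoly, ← hN, gammaProdMoment_aeval_xSum_mul _ _
    (isHomogeneous_jacobiSimplexPoly _ _), meixner_eq_gammaMoment (by rw [hx]; positivity) hp0, hx,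
    hahn_eq hα, ← hN, gammaProdMoment_scale _ (1 - p) (isHomogeneous_jacobiSimplexPoly _ _), ← hN]
  have := (rising_pos hpos N).ne'
  field_simp

/-! ### Terminating Lauricella functions -/

lemma kummerPoly_comp_C_mul_X (c z : ℝ) (m : ℕ) :
    (kummerPoly c m).comp (Polynomial.C z * Polynomial.X) =
      ∑ k ∈ Finset.range (m + 1), ((kummerPoly c m).coeff k * z ^ k) • Polynomial.X ^ k := by
  rw [Polynomial.comp_eq_aeval, Polynomial.aeval_eq_sum_range'
    (Nat.lt_succ_of_le (natDegree_kummerPoly_le c m))]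
  refine Finset.sum_congr rfl fun k _ => ?_
  rw [mul_pow, ← Polynomial.C_pow, ← Polynomial.smul_eq_C_mul, smul_smul]

lemma prod_kummerPoly_comp {d : ℕ} (c z : Fin d → ℝ) (m : Fin d → ℕ) :
    ∏ i, (kummerPoly (c i) (m i)).comp (Polynomial.C (z i) * Polynomial.X) =
      ∑ l ∈ Fintype.piFinset fun i => Finset.range (m i + 1),
        ((∏ i, (kummerPoly (c i) (m i)).coeff (l i)) * ∏ i, z i ^ l i) •
          (Polynomial.X ^ ∑ i, l i : Polynomial ℝ) := by
  simp only [kummerPoly_comp_C_mul_X, Finset.prod_univ_sum, Finset.prod_smul,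
    Finset.prod_mul_distrib, Finset.prod_pow_eq_pow_sum]

/-- The parameters `-m i` cut the series off at `l i ≤ m i`, and `(a)_{|l|}` is the Gamma moment of
order `|l|`. The series is thus the moment of a product of `₁F₁` polynomials in one variable. -/
lemma lauricellaA_neg_natCast {d : ℕ} (a : ℝ) (m : Fin d → ℕ) (c z : Fin d → ℝ) :
    lauricellaA a (fun i => -(m i : ℝ)) c z = gammaMoment a 1
      (∏ i, (kummerPoly (c i) (m i)).comp (Polynomial.C (z i) * Polynomial.X)) := by
  rw [prod_kummerPoly_comp, map_sum, lauricellaA,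
    tsum_eq_sum (s := Fintype.piFinset fun i => Finset.range (m i + 1))]
  · refine Finset.sum_congr rfl fun l _ => ?_
    rw [map_smul, gammaMoment_X_pow, one_pow, one_mul, smul_eq_mul, mul_comm,
      ← Finset.prod_mul_distrib]
    congr 1
    refine Finset.prod_congr rfl fun i _ => ?_
    rw [rising_neg_div, coeff_kummerPoly]
  · intro l hl
    rw [Fintype.mem_piFinset] at hl
    push Not at hl
    obtain ⟨i, hi⟩ := hl
    rw [Finset.prod_eq_zero (Finset.mem_univ i), mul_zero]
    rw [rising_neg_div, Nat.choose_eq_zero_of_lt (by simpa using hi)]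
    simp

/-- Expanding `X ^ N` in the polynomials `₁F₁(-i; a; X)` turns each summand into a triple-product
moment, so the coefficient is a Fourier coefficient of `X ^ N` times a Laguerre polynomial. -/
lemma lauricellaCoeff_eq_gammaMoment {a : ℝ} (ha : 0 < a) (N q j : ℕ) :
    lauricellaCoeff a N q j = gammaMoment a 1
      (Polynomial.X ^ N * laguerrePoly (a + 2 * N) q * kummerPoly a j) := by
  have h : ∀ i : ℕ, lauricellaA a ![-(i : ℝ), -(q : ℝ), -(j : ℝ)] ![a, a + 2 * N, a] ![1, 1, 1] =
      gammaMoment a 1 (kummerPoly a i * kummerPoly (a + 2 * N) q * kummerPoly a j) := by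
    intro i
    have := lauricellaA_neg_natCast a ![i, q, j] ![a, a + 2 * N, a] ![1, 1, 1]
    rw [show (fun t => -((![i, q, j] : Fin 3 → ℕ) t : ℝ)) = ![-(i : ℝ), -(q : ℝ), -(j : ℝ)] by
      funext t; fin_cases t <;> rfl] at this
    rw [this]
    simp [Fin.prod_univ_three]
  rw [lauricellaCoeff, X_pow_eq_sum_kummerPoly ha N, laguerrePoly]
  simp only [h, Finset.sum_mul, Finset.mul_sum, map_sum, ← Polynomial.smul_eq_C_mul,
    smul_mul_assoc, mul_smul_comm, map_smul, smul_eq_mul]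
  refine Finset.sum_congr rfl fun i _ => ?_
  have : (i.factorial : ℝ) ≠ 0 := by positivity
  have : (q.factorial : ℝ) ≠ 0 := by positivity
  field_simp

/-- Parseval's identity. The bound `N + q ≤ n` makes the range of `j` long enough for the complete
expansion. -/
lemma sum_lauricellaCoeff_mul_gammaMoment {a : ℝ} (ha : 0 < a) {N q n : ℕ} (h : N + q ≤ n)
    (W : Polynomial ℝ) :
    ∑ j ∈ Finset.range (n + 1), lauricellaCoeff a N q j * (rising a j / j.factorial) *
      gammaMoment a 1 (W * kummerPoly a j) =
        gammaMoment a 1 (W * (Polynomial.X ^ N * laguerrePoly (a + 2 * N) q)) := by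
  have hd : (Polynomial.X ^ N * laguerrePoly (a + 2 * N) q).natDegree ≤ n :=
    Polynomial.natDegree_mul_le.trans ((add_le_add (Polynomial.natDegree_X_pow_le N)
      (natDegree_laguerrePoly_le _ q)).trans h)
  conv_rhs => rw [eq_sum_gammaMoment_mul_kummerPoly ha hd]
  rw [Finset.mul_sum, map_sum]
  refine Finset.sum_congr rfl fun j _ => ?_
  rw [lauricellaCoeff_eq_gammaMoment ha, mul_smul_comm, map_smul, smul_eq_mul]

lemma laguerreProdPoly_eq_sum {d : ℕ} (α : Fin d → ℝ) (m : Fin d → ℕ) :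
    laguerreProdPoly α m = (∏ i, rising (α i) (m i) / (m i).factorial) •
      ∑ l ∈ Fintype.piFinset fun i => Finset.range (m i + 1),
        (∏ i, (kummerPoly (α i) (m i)).coeff (l i)) • xPow l := by
  have h : ∀ i, Polynomial.aeval (MvPolynomial.X i : MvPolynomial (Fin d) ℝ)
      (laguerrePoly (α i) (m i)) = (rising (α i) (m i) / (m i).factorial) •
        ∑ k ∈ Finset.range (m i + 1),
          (kummerPoly (α i) (m i)).coeff k • MvPolynomial.X i ^ k := by
    intro i
    rw [laguerrePoly, ← Polynomial.smul_eq_C_mul, map_smul,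
      Polynomial.aeval_eq_sum_range' (Nat.lt_succ_of_le (natDegree_kummerPoly_le _ _))]
  rw [laguerreProdPoly, Finset.prod_congr rfl fun i _ => h i, Finset.prod_smul,
    Finset.prod_univ_sum]
  simp only [Finset.prod_smul, xPow]

/-! ### Connection coefficients -/

lemma integral_laguerreStar_mul_laguerreProd {k : ℕ} {α : Fin (k + 1) → ℝ} (hα : ∀ i, 0 < α i)
    (n m : Fin (k + 1) → ℕ) :
    Integrable (fun y => laguerreStar α n y * laguerreProd α m y) (gammaProd α 1) ∧
      connCoeff α m n = gammaProdMoment α 1 (laguerreStarPoly α n * laguerreProdPoly α m) := by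
  have hae : (fun y => MvPolynomial.eval (fun i => y i * 1)
      (laguerreStarPoly α n * laguerreProdPoly α m)) =ᵐ[gammaProd α 1]
      fun y => laguerreStar α n y * laguerreProd α m y := by
    filter_upwards [ae_pos_gammaProd hα one_pos] with y hy
    simp only [mul_one]
    rw [map_mul, eval_laguerreStarPoly α n hy, eval_laguerreProdPoly]
  have h := integral_gammaProd_eval hα one_pos 1 (laguerreStarPoly α n * laguerreProdPoly α m)
  rw [mul_one] at h
  exact ⟨h.1.congr hae, (integral_congr_ae hae).symm.trans h.2⟩

lemma connCoeff_eq_zero {k : ℕ} {α : Fin (k + 1) → ℝ} (hα : ∀ i, 0 < α i)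
    {n m : Fin (k + 1) → ℕ} (h : ∑ i, m i ≠ ∑ i, n i) : connCoeff α m n = 0 := by
  rw [(integral_laguerreStar_mul_laguerreProd hα n m).2]
  rcases lt_or_gt_of_ne h with hlt | hgt
  · exact (orthogonalBelow_laguerreStarPoly hα n).mul_eq_zero
      ((totalDegree_laguerreProdPoly_le α m).trans_lt hlt)
  · rw [mul_comm]
    exact (orthogonalBelow_laguerreProdPoly hα m).mul_eq_zero
      ((totalDegree_laguerreStarPoly_le α n).trans_lt hgt)

lemma laguerreStarPoly_eq_sum {k : ℕ} {α : Fin (k + 1) → ℝ} (hα : ∀ i, 0 < α i)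
    (n : Fin (k + 1) → ℕ) :
    laguerreStarPoly α n = ∑ m ∈ Finset.piAntidiag Finset.univ (∑ i, n i),
      (laguerrePhi α m * connCoeff α m n) • laguerreProdPoly α m := by
  simp only [(integral_laguerreStar_mul_laguerreProd hα n _).2]
  exact (orthogonalBelow_laguerreStarPoly hα n).eq_sum_laguerreProdPoly hα
    (totalDegree_laguerreStarPoly_le α n)

lemma lauricellaA_snoc {k : ℕ} (a : ℝ) (α t : Fin (k + 1) → ℝ) (m : Fin (k + 1) → ℕ) (j : ℕ) :
    lauricellaA a (Fin.snoc (fun i => -(m i : ℝ)) (-(j : ℝ)) : Fin (k + 2) → ℝ)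
        (Fin.snoc α a) (Fin.snoc t 1) =
      ∑ l ∈ Fintype.piFinset fun i => Finset.range (m i + 1),
        ((∏ i, (kummerPoly (α i) (m i)).coeff (l i)) *
          gammaMoment a 1 (Polynomial.X ^ (∑ i, l i) * kummerPoly a j)) *
            MvPolynomial.eval t (xPow l) := by
  have hm : (Fin.snoc (fun i => -(m i : ℝ)) (-(j : ℝ)) : Fin (k + 2) → ℝ) =
      fun i => -((Fin.snoc m j : Fin (k + 2) → ℕ) i : ℝ) := by
    funext i
    induction i using Fin.lastCases with
    | last => simp
    | cast i => simp
  rw [hm, lauricellaA_neg_natCast, Fin.prod_univ_castSucc]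
  simp only [Fin.snoc_castSucc, Fin.snoc_last, map_one, one_mul, Polynomial.comp_X]
  rw [prod_kummerPoly_comp, Finset.sum_mul, map_sum]
  refine Finset.sum_congr rfl fun l _ => ?_
  rw [smul_mul_assoc, map_smul, smul_eq_mul, eval_xPow]
  ring

lemma integral_jacobiSimplex_mul_lauricellaA {k : ℕ} {α : Fin (k + 1) → ℝ} (hα : ∀ i, 0 < α i)
    (N : Fin k → ℕ) (m : Fin (k + 1) → ℕ) (j : ℕ) :
    ∫ t, jacobiSimplex α N t * lauricellaA (∑ i, α i)
        (Fin.snoc (fun i => -(m i : ℝ)) (-(j : ℝ)) : Fin (k + 2) → ℝ)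
        (Fin.snoc α (∑ i, α i)) (Fin.snoc t 1) ∂(dirichlet α) =
      ∑ l ∈ Fintype.piFinset fun i => Finset.range (m i + 1),
        ((∏ i, (kummerPoly (α i) (m i)).coeff (l i)) *
          gammaMoment (∑ i, α i) 1 (Polynomial.X ^ (∑ i, l i) * kummerPoly (∑ i, α i) j)) *
            (gammaProdMoment α 1 (jacobiSimplexPoly α N * xPow l) /
              rising (∑ i, α i) ((∑ i, N i) + ∑ i, l i)) := by
  simp only [lauricellaA_snoc, Finset.mul_sum, mul_left_comm (jacobiSimplex α N _)]
  rw [integral_finsetSum _ fun (l : Fin (k + 1) → ℕ) _ =>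
    (integral_dirichlet_jacobiSimplex_mul hα α N (isHomogeneous_xPow l)).1.const_mul _]
  refine Finset.sum_congr rfl fun l _ => ?_
  rw [integral_const_mul,
    (integral_dirichlet_jacobiSimplex_mul hα α N (isHomogeneous_xPow l)).2]

/-- The prefactor reduces to the normalization of `L_m^α`, and the two sides are compared for each
monomial `l` of that polynomial. The sum over `j` restores `X ^ N` times the radial Laguerre factor,
by Parseval. -/
lemma connCoeff_eq_of_sum_eq {k : ℕ} {α : Fin (k + 1) → ℝ} (hα : ∀ i, 0 < α i)
    {n m : Fin (k + 1) → ℕ} (h : ∑ i, m i = ∑ i, n i) :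
    connCoeff α m n =
      rising (∑ i, α i) (∑ i, n i) / (∑ i, n i).factorial * dirichletMultinomial α m *
        ∑ j ∈ Finset.range (∑ i, n i + 1),
          lauricellaCoeff (∑ i, α i) (∑ i : Fin k, n i.castSucc) (n (Fin.last k)) j *
            (rising (∑ i, α i) j / j.factorial) *
            ∫ t, jacobiSimplex α (fun i : Fin k => n i.castSucc) t *
              lauricellaA (∑ i, α i)
                (Fin.snoc (fun i => -(m i : ℝ)) (-(j : ℝ)) : Fin (k + 2) → ℝ)
                (Fin.snoc α (∑ i, α i)) (Fin.snoc t 1) ∂(dirichlet α) := by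
  have hS := sum_pos_of_pos hα
  set N := ∑ i : Fin k, n i.castSucc with hN
  have hpre : rising (∑ i, α i) (∑ i, n i) / (∑ i, n i).factorial * dirichletMultinomial α m =
      ∏ i, rising (α i) (m i) / (m i).factorial := by
    rw [dirichletMultinomial, h, Finset.prod_div_distrib]
    have := (rising_pos hS (∑ i, n i)).ne'
    have : ((∑ i, n i).factorial : ℝ) ≠ 0 := by positivity
    have : (∏ i, ((m i).factorial : ℝ)) ≠ 0 := by positivity
    field_simp
  rw [hpre, (integral_laguerreStar_mul_laguerreProd hα n m).2, laguerreProdPoly_eq_sum,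
    mul_smul_comm, map_smul, smul_eq_mul]
  congr 1
  simp only [integral_jacobiSimplex_mul_lauricellaA hα, Finset.mul_sum, map_sum, mul_smul_comm,
    map_smul, smul_eq_mul]
  rw [Finset.sum_comm]
  refine Finset.sum_congr rfl fun l _ => ?_
  have hsum := sum_lauricellaCoeff_mul_gammaMoment hS (N := N) (q := n (Fin.last k))
    (n := ∑ i, n i) (by rw [Fin.sum_univ_castSucc n]) (Polynomial.X ^ ∑ i, l i)
  have hterm : ∀ j, lauricellaCoeff (∑ i, α i) N (n (Fin.last k)) j *
      (rising (∑ i, α i) j / j.factorial) * ((∏ i, (kummerPoly (α i) (m i)).coeff (l i)) *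
        gammaMoment (∑ i, α i) 1 (Polynomial.X ^ (∑ i, l i) * kummerPoly (∑ i, α i) j) *
          (gammaProdMoment α 1 (jacobiSimplexPoly α (fun i => n i.castSucc) * xPow l) /
            rising (∑ i, α i) ((∑ i : Fin k, n i.castSucc) + ∑ i, l i))) =
      (lauricellaCoeff (∑ i, α i) N (n (Fin.last k)) j * (rising (∑ i, α i) j / j.factorial) *
        gammaMoment (∑ i, α i) 1 (Polynomial.X ^ (∑ i, l i) * kummerPoly (∑ i, α i) j)) *
      ((∏ i, (kummerPoly (α i) (m i)).coeff (l i)) *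
          (gammaProdMoment α 1 (jacobiSimplexPoly α (fun i => n i.castSucc) * xPow l) /
            rising (∑ i, α i) (N + ∑ i, l i))) := fun j => by rw [hN]; ring
  simp only [hterm]
  -- Absorbing `X ^ (N + |l|)` into the shape produces `(|α|)_{N+|l|}`, which cancels the Dirichlet
  -- normalization. What is left is the splitting of the Gamma pairing into its radial and
  -- homogeneous parts.
  rw [← Finset.sum_mul, hsum, laguerreStarPoly, ← hN, mul_assoc,
    gammaProdMoment_aeval_xSum_mul α 1 ((isHomogeneous_jacobiSimplexPoly _ _).mul
      (isHomogeneous_xPow l)), ← hN, ← mul_assoc (Polynomial.X ^ _), ← pow_add, mul_comm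
        (Polynomial.X ^ _), gammaMoment_mul_X_pow, one_pow, one_mul, add_comm (∑ i, l i) N]
  have := (rising_pos hS (N + ∑ i, l i)).ne'
  field_simp

end MultiMeixner

end

open MultiMeixner in
theorem proposition6p2 (k : ℕ) (α : Fin (k + 1) → ℝ) (hα : ∀ i, 0 < α i)
    (p : ℝ) (hp0 : 0 < p) (hp1 : p < 1) :
    -- (i) two orthogonal systems
    (IsOrthogonalSystem (nbProd α p) (meixnerProd α p) ∧
      IsOrthogonalSystem (nbProd α p) (meixnerStar α p)) ∧
    -- (ii) posterior mixtures of the two Laguerre systems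
    (∀ n r : Fin (k + 1) → ℕ,
      (Integrable (fun y => poissonProd y r / nbProd α p r *
          laguerreProd α n (fun i => y i * ((1 - p) / p))) (gammaProd α (p / (1 - p))) ∧
        meixnerProd α p n r = ∫ y, poissonProd y r / nbProd α p r *
          laguerreProd α n (fun i => y i * ((1 - p) / p)) ∂(gammaProd α (p / (1 - p)))) ∧
      (Integrable (fun y => laguerreProd α n (fun i => y i * ((1 - p) / p)))
          (gammaProd (fun i => α i + r i) p) ∧
        meixnerProd α p n r = ∫ y, laguerreProd α n (fun i => y i * ((1 - p) / p))
          ∂(gammaProd (fun i => α i + r i) p)) ∧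
      (Integrable (fun y => poissonProd y r / nbProd α p r *
          laguerreStar α n (fun i => y i * ((1 - p) / p))) (gammaProd α (p / (1 - p))) ∧
        meixnerStar α p n r = ∫ y, poissonProd y r / nbProd α p r *
          laguerreStar α n (fun i => y i * ((1 - p) / p)) ∂(gammaProd α (p / (1 - p)))) ∧
      (Integrable (fun y => laguerreStar α n (fun i => y i * ((1 - p) / p)))
          (gammaProd (fun i => α i + r i) p) ∧
        meixnerStar α p n r = ∫ y, laguerreStar α n (fun i => y i * ((1 - p) / p))
          ∂(gammaProd (fun i => α i + r i) p))) ∧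
    -- (iii) connection coefficients: the same coefficients connect the two Laguerre systems and
    -- the two Meixner systems
    (∀ n : Fin (k + 1) → ℕ,
      (∀ m, Integrable (fun y => laguerreStar α n y * laguerreProd α m y) (gammaProd α 1)) ∧
      (∀ y : Fin (k + 1) → ℝ, (∀ i, 0 < y i) → laguerreStar α n y =
        ∑ m ∈ Finset.piAntidiag Finset.univ (∑ i, n i),
          laguerrePhi α m * connCoeff α m n * laguerreProd α m y) ∧
      (∀ r, meixnerStar α p n r =
        ∑ m ∈ Finset.piAntidiag Finset.univ (∑ i, n i),
          laguerrePhi α m * connCoeff α m n * meixnerProd α p m r) ∧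
      (∀ m, HasSum (fun r => nbProd α p r * (meixnerStar α p n r * meixnerProd α p m r))
        (p ^ (∑ i, n i) * connCoeff α m n)) ∧
      -- the explicit value of the coefficients
      (∀ m, connCoeff α m n =
        if ∑ i, m i = ∑ i, n i then
          rising (∑ i, α i) (∑ i, n i) / (∑ i, n i).factorial * dirichletMultinomial α m *
            ∑ j ∈ Finset.range (∑ i, n i + 1),
              lauricellaCoeff (∑ i, α i) (∑ i : Fin k, n i.castSucc) (n (Fin.last k)) j *
                (rising (∑ i, α i) j / j.factorial) *
                ∫ t, jacobiSimplex α (fun i : Fin k => n i.castSucc) t *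
                  lauricellaA (∑ i, α i) (Fin.snoc (fun i => -(m i : ℝ)) (-(j : ℝ)))
                    (Fin.snoc α (∑ i, α i)) (Fin.snoc t 1) ∂(dirichlet α)
        else 0)) := by
  have hq : 0 < 1 - p := sub_pos.2 hp1
  have hc : 0 < (1 - p) / p := div_pos hq hp0
  have hprod : meixnerProd α p = fun n r =>
      gammaProdMoment (fun i => α i + r i) (1 - p) (laguerreProdPoly α n) := by
    funext n r; exact meixnerProd_eq_gammaProdMoment hα hp0 n r
  have hstar : meixnerStar α p = fun n r =>
      gammaProdMoment (fun i => α i + r i) (1 - p) (laguerreStarPoly α n) := by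
    funext n r; exact meixnerStar_eq_gammaProdMoment hα hp0 n r
  refine ⟨⟨?_, ?_⟩, fun n r => ?_, fun n => ⟨fun m => ?_, fun y hy => ?_, fun r => ?_, fun m => ?_,
    fun m => ?_⟩⟩
  · rw [hprod]
    exact isOrthogonalSystem_gammaProdMoment hα hp0 hp1 (totalDegree_laguerreProdPoly_le α)
      (orthogonalBelow_laguerreProdPoly hα)
      (fun n m h => by rw [gammaProdMoment_laguerreProdPoly_mul hα, if_neg h])
      (laguerreProdPoly_ne_zero hα)
  · rw [hstar]
    exact isOrthogonalSystem_gammaProdMoment hα hp0 hp1 (totalDegree_laguerreStarPoly_le α)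
      (orthogonalBelow_laguerreStarPoly hα)
      (fun n m h => gammaProdMoment_laguerreStarPoly_mul_of_ne hα h) (laguerreStarPoly_ne_zero hα)
  · have hαr : ∀ i, 0 < α i + (r i : ℝ) := fun i => by have := hα i; positivity
    have hpc : p * ((1 - p) / p) = 1 - p := mul_div_cancel₀ _ hp0.ne'
    have h1 := integral_gammaProd_poissonProd_mul_eval hα hp0 hp1 r (laguerreProdPoly α n)
    have h2 := integral_gammaProd_eval hαr hp0 ((1 - p) / p) (laguerreProdPoly α n)
    have h3 := integral_gammaProd_poissonProd_mul_eval hα hp0 hp1 r (laguerreStarPoly α n)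
    have h4 := integral_gammaProd_eval hαr hp0 ((1 - p) / p) (laguerreStarPoly α n)
    rw [hpc] at h2 h4
    simp only [eval_laguerreProdPoly] at h1 h2
    -- `laguerreStar` divides by `|y|` and agrees with its polynomial form at points with positive
    -- coordinates, which carry the whole Gamma law.
    have e3 : (fun y => poissonProd y r / nbProd α p r *
        MvPolynomial.eval (fun i => y i * ((1 - p) / p)) (laguerreStarPoly α n))
        =ᵐ[gammaProd α (p / (1 - p))] fun y => poissonProd y r / nbProd α p r *
          laguerreStar α n fun i => y i * ((1 - p) / p) := by
      filter_upwards [ae_pos_gammaProd hα (div_pos hp0 hq)] with y hy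
      rw [eval_laguerreStarPoly α n fun i => mul_pos (hy i) hc]
    have e4 : (fun y => MvPolynomial.eval (fun i => y i * ((1 - p) / p)) (laguerreStarPoly α n))
        =ᵐ[gammaProd (fun i => α i + r i) p] fun y =>
          laguerreStar α n fun i => y i * ((1 - p) / p) := by
      filter_upwards [ae_pos_gammaProd hαr hp0] with y hy
      rw [eval_laguerreStarPoly α n fun i => mul_pos (hy i) hc]
    rw [hprod, hstar]
    exact ⟨⟨h1.1, h1.2.symm⟩, ⟨h2.1, h2.2.symm⟩,
      ⟨h3.1.congr e3, h3.2.symm.trans (integral_congr_ae e3)⟩,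
      ⟨h4.1.congr e4, h4.2.symm.trans (integral_congr_ae e4)⟩⟩
  · exact (integral_laguerreStar_mul_laguerreProd hα n m).1
  · rw [← eval_laguerreStarPoly α n hy, laguerreStarPoly_eq_sum hα n, map_sum]
    simp only [MvPolynomial.smul_eval, eval_laguerreProdPoly]
  · rw [hprod, hstar]
    dsimp only
    rw [laguerreStarPoly_eq_sum hα n, map_sum]
    simp only [map_smul, smul_eq_mul]
  · rw [hprod, hstar]
    rcases le_or_gt (∑ i, m i) (∑ i, n i) with h | h
    · rw [(integral_laguerreStar_mul_laguerreProd hα n m).2]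
      exact (orthogonalBelow_laguerreStarPoly hα n).hasSum_nbProd_mul hα hp0 hp1
        ((totalDegree_laguerreProdPoly_le α m).trans h)
    -- For `|m| > |n|` the isometry is applied with the roles exchanged. Its power of `p` is then `p
    -- ^ |m|`, which is harmless because the coefficient is zero.
    · rw [connCoeff_eq_zero hα h.ne', mul_zero]
      have h2 := (orthogonalBelow_laguerreProdPoly hα m).hasSum_nbProd_mul hα hp0 hp1
        ((totalDegree_laguerreStarPoly_le α n).trans h.le)
      rw [mul_comm (laguerreProdPoly α m), ← (integral_laguerreStar_mul_laguerreProd hα n m).2,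
        connCoeff_eq_zero hα h.ne', mul_zero] at h2
      simpa only [mul_comm (gammaProdMoment _ _ (laguerreProdPoly α m))] using h2
  · split_ifs with h
    · exact connCoeff_eq_of_sum_eq hα h
    · exact connCoeff_eq_zero hα h
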